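/- Let $(G,c)$ be a network: a vertex set $G$ with a symmetric function $c:G\times G\to[0,\infty)$, $c_{xx}=0$, such that the graph with edges $x\sim y\iff c_{xy}>0$ is connected and every vertex has finitely many neighbours; fix a vertex $o\in G$. For $u:G\to\mathbb R$ put $(\Delta u)(x)=\sum_{y\sim x}c_{xy}(u(x)-u(y))$ and $\mathcal E(u,v)=\frac12\sum_{x,y\in G}c_{xy}(u(x)-u(y))(v(x)-v(y))$. The energy space is the Hilbert space $\mathcal H_{\mathcal E}=\{u:\mathcal E(u,u)<\infty\}/\mathbb R\mathbf 1$ with inner product $\mathcal E$, and $\mathrm{Harm}=\{u\in\mathcal H_{\mathcal E}:\Delta u=0\}$. Let $\delta_x$ be the Dirac mass at $x$, regarded as an element of $\ell^2(G)$ or of $\mathcal H_{\mathcal E}$, and let $v_x\in\mathcal H_{\mathcal E}$ be the element with $\langle v_x,u\rangle_{\mathcal E}=u(x)-u(o)$ for all $u\in\mathcal H_{\mathcal E}$. If there is an element $w\in\mathcal H_{\mathcal E}$ with $\Delta w=\delta_o$ pointwise (a monopole at $o$), let $w_o$ be the one of least energy. Define the following operators. * $J:\ell^2(G)\to\mathcal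 H_{\mathcal E}$ is the closure of the inclusion operator $\delta_x\mapsto\delta_x$ defined on $\operatorname{span}\{\delta_x\}_{x\in G}\subseteq\ell^2(G)$. * $\Delta_{\ell^2}$ is the closure in $\ell^2(G)$ of $\Delta$ on $\operatorname{span}\{\delta_x\}_{x\in G}$. * $\Delta_{\mathcal H_{\mathcal E}}$ is the closure in $\mathcal H_{\mathcal E}$ of $\Delta$ on $\operatorname{span}\{w_o+v_x\}_{x\in G}$ if monopoles exist, and on $\operatorname{span}\{v_x\}_{x\in G}$ otherwise. Then these three operators are closable before the closure is taken, and, with the natural domains for products of operators: (i) $\Delta_{\ell^2}$ is self-adjoint and $J^*J=\Delta_{\ell^2}$. (ii) $JJ^*$ is the Krein extension of $\Delta_{\mathcal H_{\mathcal E}}$: it is a self-adjoint extension of $\Delta_{\mathcal H_{\mathcal E}}$ with $\ker\Delta_{\mathcal H_{\mathcal E}}^*\subseteq\ker JJ^*$. Here $\ker\Delta_{\mathcal H_{\mathcal E}}^*=\mathrm{Harm}$. Moreover $JJ^*$ is the smallest non-negative self-adjoint extension of $\Delta_{\mathcal H_{\mathcal E}}$ in the usual ordering ($A\le B$ iff $(B+1)^{-1}\le(A+1)^{-1}$).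 -/

import Mathlib

open scoped LinearPMap ENNReal

noncomputable section

/-! ### Partially defined operators between Hilbert spaces -/

namespace LinearPMap

variable {E F K : Type*}

/-- The composition `g ∘ f` of two unbounded operators on its natural domain
`{x ∈ dom f | f x ∈ dom g}`. -/
def natComp [AddCommGroup E] [Module ℝ E] [AddCommGroup F] [Module ℝ F]
    [AddCommGroup K] [Module ℝ K] (g : F →ₗ.[ℝ] K) (f : E →ₗ.[ℝ] F) : E →ₗ.[ℝ] K :=
  g.comp (f.domRestrict ((g.domain.comap f.toFun).map f.domain.subtype)) (by
    rintro ⟨x, hx, hx'⟩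
    obtain ⟨y, hy, rfl⟩ := hx
    exact hy)

/-- The kernel of an unbounded operator: the vectors of its domain that it sends to `0`. -/
def kernel [AddCommGroup E] [Module ℝ E] [AddCommGroup F] [Module ℝ F]
    (T : E →ₗ.[ℝ] F) : Submodule ℝ E :=
  (LinearMap.ker T.toFun).map T.domain.subtype

theorem mem_domain_natComp [AddCommGroup E] [Module ℝ E] [AddCommGroup F] [Module ℝ F]
    [AddCommGroup K] [Module ℝ K] (g : F →ₗ.[ℝ] K) (f : E →ₗ.[ℝ] F) (x : E) :
    x ∈ (g.natComp f).domain ↔ ∃ h : x ∈ f.domain, f ⟨x, h⟩ ∈ g.domain := by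
  constructor
  · rintro ⟨⟨y, hy, rfl⟩, hx'⟩
    exact ⟨y.2, hy⟩
  · rintro ⟨h, h'⟩
    exact ⟨⟨⟨x, h⟩, h', rfl⟩, h⟩

theorem mem_kernel [AddCommGroup E] [Module ℝ E] [AddCommGroup F] [Module ℝ F]
    (T : E →ₗ.[ℝ] F) (x : E) : x ∈ T.kernel ↔ ∃ h : x ∈ T.domain, T ⟨x, h⟩ = 0 := by
  constructor
  · rintro ⟨y, hy, rfl⟩
    exact ⟨y.2, hy⟩
  · rintro ⟨h, h'⟩
    exact ⟨⟨x, h⟩, h', rfl⟩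

variable [NormedAddCommGroup E] [InnerProductSpace ℝ E]

/-- `⟨u, T u⟩ ≥ 0` on the domain of `T`. -/
def IsNonneg (T : E →ₗ.[ℝ] E) : Prop :=
  ∀ u : T.domain, 0 ≤ inner ℝ (u : E) (T u)

/-- The usual ordering `A ≤ B` of non-negative self-adjoint operators, expressed by the
resolvents: `(B + 1)⁻¹ ≤ (A + 1)⁻¹` as quadratic forms.  Here `u = (A + 1)⁻¹ f` and
`w = (B + 1)⁻¹ f` for the common value `f = u + A u = w + B w`. -/
def ResolventLE (A B : E →ₗ.[ℝ] E) : Prop :=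
  ∀ (f : E) (u : A.domain) (w : B.domain), (u : E) + A u = f → (w : E) + B w = f →
    inner ℝ f (w : E) ≤ inner ℝ f (u : E)

/-- `T` is a Krein extension of `S`: a self-adjoint extension whose domain contains
`ker S†` and which vanishes there. -/
structure IsKreinExtension [CompleteSpace E] (S T : E →ₗ.[ℝ] E) : Prop where
  isSelfAdjoint : IsSelfAdjoint T
  extends_op : S ≤ T
  ker_adjoint_le : S†.kernel ≤ T.kernel

/-- `T` is the smallest non-negative self-adjoint extension of `S`. -/
structure IsLeastNonnegExtension [CompleteSpace E] (S T : E →ₗ.[ℝ] E) : Prop where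
  isSelfAdjoint : IsSelfAdjoint T
  nonneg : T.IsNonneg
  extends_op : S ≤ T
  least : ∀ T' : E →ₗ.[ℝ] E, IsSelfAdjoint T' → T'.IsNonneg → S ≤ T' → ResolventLE T T'

end LinearPMap

/-! ### Networks -/

/-- A (resistance) network on the vertex set `G`: a connected, locally finite, undirected
weighted graph without loops; `x` and `y` are neighbours iff `0 < c x y`. -/
structure Network (G : Type*) where
  c : G → G → ℝ
  nonneg : ∀ x y, 0 ≤ c x y
  symm : ∀ x y, c x y = c y x
  loopless : ∀ x, c x x = 0
  locallyFinite : ∀ x, {y | 0 < c x y}.Finite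
  connected : ∀ x y, Relation.ReflTransGen (fun a b => 0 < c a b) x y

namespace Network

variable {G : Type*} (N : Network G)

/-- The finite set of neighbours of `x`. -/
def nbrs (x : G) : Finset G := (N.locallyFinite x).toFinset

theorem mem_nbrs {x y : G} : y ∈ N.nbrs x ↔ 0 < N.c x y := by simp [nbrs]

theorem c_eq_zero {x y : G} (h : y ∉ N.nbrs x) : N.c x y = 0 :=
  le_antisymm (not_lt.1 (fun h' => h (N.mem_nbrs.2 h'))) (N.nonneg x y)

/-- The Laplacian `(Δ u)(x) = ∑_{y ∼ x} c_{xy} (u x - u y)` on all functions. -/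
def lap : (G → ℝ) →ₗ[ℝ] (G → ℝ) where
  toFun u x := ∑ y ∈ N.nbrs x, N.c x y * (u x - u y)
  map_add' u v := by
    ext x
    simp only [Pi.add_apply, ← Finset.sum_add_distrib]
    exact Finset.sum_congr rfl fun y _ => by ring
  map_smul' r u := by
    ext x
    simp only [Pi.smul_apply, smul_eq_mul, RingHom.id_apply, Finset.mul_sum]
    exact Finset.sum_congr rfl fun y _ => by ring

theorem lap_apply (u : G → ℝ) (x : G) :
    N.lap u x = ∑ y ∈ N.nbrs x, N.c x y * (u x - u y) := rfl

theorem lap_support_finite {u : G → ℝ} (hu : u.support.Finite) :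
    (N.lap u).support.Finite := by
  refine (hu.union (hu.biUnion fun x _ => (N.nbrs x).finite_toSet)).subset ?_
  intro x hx
  by_contra hcon
  simp only [Set.mem_union, Function.mem_support, ne_eq, Set.mem_iUnion, Finset.mem_coe,
    exists_prop, not_or, not_not, not_exists, not_and] at hcon
  refine hx (Finset.sum_eq_zero fun y hy => ?_)
  have hyx : x ∈ N.nbrs y := by
    rw [mem_nbrs, N.symm y x]
    exact N.mem_nbrs.1 hy
  have : u y = 0 := by
    by_contra h
    exact hcon.2 y h hyx
  rw [hcon.1, this]
  simp

/-! ### The energy space -/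

/-- The energy form
`𝓔(u, v) = ½ ∑_{x, y} c_{xy} (u x - u y) (v x - v y)`. -/
def energy (u v : G → ℝ) : ℝ :=
  (1 / 2) * ∑' p : G × G, N.c p.1 p.2 * (u p.1 - u p.2) * (v p.1 - v p.2)

/-- The sum that defines `𝓔(u, u)` converges. -/
def FiniteEnergy (u : G → ℝ) : Prop :=
  Summable fun p : G × G => N.c p.1 p.2 * (u p.1 - u p.2) * (u p.1 - u p.2)

theorem FiniteEnergy.summable {u v : G → ℝ} (hu : N.FiniteEnergy u) (hv : N.FiniteEnergy v) :
    Summable fun p : G × G => N.c p.1 p.2 * (u p.1 - u p.2) * (v p.1 - v p.2) := by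
  refine Summable.of_norm_bounded (hu.add hv) fun p => ?_
  have hc := N.nonneg p.1 p.2
  rw [Real.norm_eq_abs, mul_assoc, abs_mul, abs_of_nonneg hc, mul_assoc, mul_assoc, ← mul_add]
  refine mul_le_mul_of_nonneg_left ?_ hc
  rw [abs_le]
  constructor <;> nlinarith [sq_nonneg ((u p.1 - u p.2) + (v p.1 - v p.2)),
    sq_nonneg ((u p.1 - u p.2) - (v p.1 - v p.2)), sq_nonneg (u p.1 - u p.2),
    sq_nonneg (v p.1 - v p.2)]

/-- The domain of the energy form: the functions of finite energy. -/
def domEnergy : Submodule ℝ (G → ℝ) where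
  carrier := {u | N.FiniteEnergy u}
  zero_mem' := by
    simp only [Set.mem_ofPred_eq, FiniteEnergy, Pi.zero_apply, sub_self, mul_zero]
    exact summable_zero
  add_mem' {u v} hu hv := by
    have h := ((FiniteEnergy.summable N hu hu).add (FiniteEnergy.summable N hu hv)).add
      ((FiniteEnergy.summable N hv hu).add (FiniteEnergy.summable N hv hv))
    refine h.congr fun p => ?_
    simp only [Pi.add_apply]
    ring
  smul_mem' r u hu := by
    refine (Summable.mul_left (r ^ 2) hu).congr fun p => ?_
    simp only [Pi.smul_apply, smul_eq_mul]
    ring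

theorem mem_domEnergy {u : G → ℝ} : u ∈ N.domEnergy ↔ N.FiniteEnergy u := Iff.rfl

theorem mem_domEnergy_of_finite_support {u : G → ℝ} (hu : u.support.Finite) :
    u ∈ N.domEnergy := by
  refine summable_of_hasFiniteSupport ?_
  have hfin : (⋃ x ∈ u.support, ((N.nbrs x : Set G).image (fun y => (x, y)) ∪
      (N.nbrs x : Set G).image (fun y => (y, x)))).Finite :=
    hu.biUnion fun x _ => ((N.nbrs x).finite_toSet.image _).union ((N.nbrs x).finite_toSet.image _)
  refine hfin.subset ?_
  rintro ⟨x, y⟩ hxy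
  simp only [Function.mem_support, ne_eq, mul_eq_zero, not_or] at hxy
  have hc : y ∈ N.nbrs x := by
    by_contra h
    exact hxy.1.1 (N.c_eq_zero h)
  have hc' : x ∈ N.nbrs y := by
    rw [mem_nbrs, N.symm y x]
    exact N.mem_nbrs.1 hc
  simp only [Set.mem_iUnion, exists_prop]
  by_cases hx : u x = 0
  · have hy : u y ≠ 0 := fun h => hxy.2 (by rw [hx, h, sub_self])
    exact ⟨y, hy, Or.inr ⟨x, hc', rfl⟩⟩
  · exact ⟨x, hx, Or.inl ⟨y, hc, rfl⟩⟩

/-- The constant functions `ℝ 𝟏`, inside the functions of finite energy. -/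
def constants : Submodule ℝ N.domEnergy :=
  (Submodule.span ℝ {(1 : G → ℝ)}).comap N.domEnergy.subtype

/-- The energy space `dom 𝓔 / ℝ 𝟏`. -/
def HE : Type _ := N.domEnergy ⧸ N.constants

instance : AddCommGroup N.HE := inferInstanceAs (AddCommGroup (N.domEnergy ⧸ N.constants))

instance : Module ℝ N.HE := inferInstanceAs (Module ℝ (N.domEnergy ⧸ N.constants))

/-- The class in the energy space of a function of finite energy. -/
def toHE : N.domEnergy →ₗ[ℝ] N.HE := N.constants.mkQ

theorem toHE_surjective : Function.Surjective N.toHE := Submodule.mkQ_surjective _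

theorem mem_constants {u : N.domEnergy} : u ∈ N.constants ↔ ∃ k : ℝ, ∀ x, (u : G → ℝ) x = k := by
  rw [constants, Submodule.mem_comap, Submodule.mem_span_singleton]
  constructor
  · rintro ⟨k, hk⟩
    exact ⟨k, fun x => by simpa using (congrFun hk x).symm⟩
  · rintro ⟨k, hk⟩
    exact ⟨k, by ext x; simpa using (hk x).symm⟩

theorem toHE_eq_zero {u : N.domEnergy} : N.toHE u = 0 ↔ u ∈ N.constants :=
  Submodule.Quotient.mk_eq_zero _

/-- The differences `(x, y) ↦ u x - u y`, which depend only on the class of `u`. -/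
def grad : N.HE →ₗ[ℝ] (G × G → ℝ) :=
  N.constants.liftQ
    { toFun := fun u p => (u : G → ℝ) p.1 - (u : G → ℝ) p.2
      map_add' := fun u v => by
        ext p
        simp only [Submodule.coe_add, Pi.add_apply]
        ring
      map_smul' := fun r u => by
        ext p
        simp only [Submodule.coe_smul, Pi.smul_apply, smul_eq_mul, RingHom.id_apply]
        ring }
    (by
      intro u hu
      obtain ⟨k, hk⟩ := N.mem_constants.1 hu
      rw [LinearMap.mem_ker]
      ext p
      simp [hk])

@[simp] theorem grad_toHE (u : N.domEnergy) (p : G × G) :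
    N.grad (N.toHE u) p = (u : G → ℝ) p.1 - (u : G → ℝ) p.2 := rfl

theorem summable_grad (u v : N.HE) :
    Summable fun p : G × G => N.c p.1 p.2 * N.grad u p * N.grad v p := by
  obtain ⟨u, rfl⟩ := N.toHE_surjective u
  obtain ⟨v, rfl⟩ := N.toHE_surjective v
  exact FiniteEnergy.summable N u.2 v.2

theorem eq_zero_of_grad {u : N.HE} (h : ∀ x y, 0 < N.c x y → N.grad u (x, y) = 0) : u = 0 := by
  obtain ⟨u, rfl⟩ := N.toHE_surjective u
  rw [toHE_eq_zero, mem_constants]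
  rcases isEmpty_or_nonempty G with hG | ⟨⟨o⟩⟩
  · exact ⟨0, fun x => isEmptyElim x⟩
  · refine ⟨(u : G → ℝ) o, fun x => ?_⟩
    induction N.connected o x with
    | refl => rfl
    | tail _ hbc ih =>
      have := h _ _ hbc
      simp only [grad_toHE] at this
      linarith

/-- The inner product `⟨u, v⟩ = 𝓔(u, v)` on the energy space. -/
@[reducible] def innerCore : InnerProductSpace.Core ℝ N.HE where
  inner u v := (1 / 2) * ∑' p : G × G, N.c p.1 p.2 * N.grad u p * N.grad v p
  conj_inner_symm u v := by
    simp only [conj_trivial]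
    congr 1
    exact tsum_congr fun p => by ring
  re_inner_nonneg u := by
    refine mul_nonneg (by norm_num) (tsum_nonneg fun p => ?_)
    rw [mul_assoc]
    exact mul_nonneg (N.nonneg _ _) (mul_self_nonneg _)
  add_left u v w := by
    rw [← mul_add, ← (N.summable_grad u w).tsum_add (N.summable_grad v w)]
    congr 1
    exact tsum_congr fun p => by simp only [map_add, Pi.add_apply]; ring
  smul_left u v r := by
    simp only [conj_trivial]
    rw [mul_left_comm, ← tsum_mul_left (a := r)]
    congr 1
    exact tsum_congr fun p => by simp only [map_smul, Pi.smul_apply, smul_eq_mul]; ring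
  definite u hu := by
    have h0 : ∑' p : G × G, N.c p.1 p.2 * N.grad u p * N.grad u p = 0 := by
      have : (1 / 2 : ℝ) * ∑' p : G × G, N.c p.1 p.2 * N.grad u p * N.grad u p = 0 := hu
      linarith
    have hnn : ∀ p : G × G, 0 ≤ N.c p.1 p.2 * N.grad u p * N.grad u p := fun p => by
      rw [mul_assoc]
      exact mul_nonneg (N.nonneg _ _) (mul_self_nonneg _)
    refine N.eq_zero_of_grad fun x y hxy => ?_
    have := congrFun ((hasSum_zero_iff_of_nonneg hnn).1 (h0 ▸ (N.summable_grad u u).hasSum)) (x, y)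
    simpa [hxy.ne'] using this

instance : NormedAddCommGroup N.HE := N.innerCore.toNormedAddCommGroup

instance : InnerProductSpace ℝ N.HE := InnerProductSpace.ofCore N.innerCore.toCore

theorem inner_def (u v : N.HE) :
    inner ℝ u v = (1 / 2) * ∑' p : G × G, N.c p.1 p.2 * N.grad u p * N.grad v p := rfl

theorem inner_toHE (u v : N.domEnergy) : inner ℝ (N.toHE u) (N.toHE v) = N.energy u v := rfl

theorem norm_sq_eq (u : N.HE) :
    ‖u‖ ^ 2 = (1 / 2) * ∑' p : G × G, N.c p.1 p.2 * N.grad u p * N.grad u p := by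
  rw [← real_inner_self_eq_norm_sq, inner_def]

theorem energy_term_nonneg (u : N.HE) (p : G × G) :
    0 ≤ N.c p.1 p.2 * N.grad u p * N.grad u p := by
  rw [mul_assoc]
  exact mul_nonneg (N.nonneg _ _) (mul_self_nonneg _)

theorem sum_le_norm_sq (u : N.HE) (s : Finset (G × G)) :
    ∑ p ∈ s, N.c p.1 p.2 * N.grad u p * N.grad u p ≤ 2 * ‖u‖ ^ 2 := by
  have := (N.summable_grad u u).sum_le_tsum s (fun p _ => N.energy_term_nonneg u p)
  rw [norm_sq_eq]
  linarith

/-- The differences of point evaluations are bounded on the energy space. -/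
theorem exists_grad_bound (x y : G) : ∃ C : ℝ, ∀ u : N.HE, |N.grad u (x, y)| ≤ C * ‖u‖ := by
  have cocycle : ∀ (u : N.HE) (a b d : G),
      N.grad u (a, d) = N.grad u (a, b) + N.grad u (b, d) := by
    intro u a b d
    obtain ⟨u, rfl⟩ := N.toHE_surjective u
    simp
  induction N.connected x y with
  | refl =>
    refine ⟨0, fun u => ?_⟩
    obtain ⟨u, rfl⟩ := N.toHE_surjective u
    simp
  | @tail b d _ hbd ih =>
    obtain ⟨C, hC⟩ := ih
    refine ⟨C + Real.sqrt (2 / N.c b d), fun u => ?_⟩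
    rw [cocycle u x b d, add_mul]
    refine (abs_add_le _ _).trans (add_le_add (hC u) ?_)
    have h := N.sum_le_norm_sq u {(b, d)}
    rw [Finset.sum_singleton] at h
    refine abs_le_of_sq_le_sq ?_ (by positivity)
    rw [mul_pow, Real.sq_sqrt (by positivity), div_mul_eq_mul_div, le_div_iff₀ hbd]
    simp only at h
    linarith

instance : CompleteSpace N.HE := by
  refine Metric.complete_of_cauchySeq_tendsto fun a ha => ?_
  rcases isEmpty_or_nonempty G with hG | ⟨⟨o⟩⟩
  · have hz : ∀ u : N.HE, u = 0 := fun u => N.eq_zero_of_grad fun x => isEmptyElim x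
    exact ⟨0, tendsto_const_nhds.congr fun n => (hz (a n)).symm⟩
  choose f hf using fun n => N.toHE_surjective (a n)
  have hcau : ∀ x, CauchySeq fun n => N.grad (a n) (x, o) := by
    intro x
    obtain ⟨C, hC⟩ := N.exists_grad_bound x o
    let φ : N.HE →L[ℝ] ℝ :=
      LinearMap.mkContinuous ((LinearMap.proj (x, o)).comp N.grad) C hC
    exact φ.uniformContinuous.comp_cauchySeq ha
  choose U hU using fun x => cauchySeq_tendsto_of_complete (hcau x)
  have hUp : ∀ p : G × G, Filter.Tendsto (fun n => N.grad (a n) p) Filter.atTop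
      (nhds (U p.1 - U p.2)) := by
    intro p
    refine ((hU p.1).sub (hU p.2)).congr fun n => ?_
    rw [← hf n]
    simp
  have key : ∀ n (ε : ℝ), (∀ m ≥ n, ‖a n - a m‖ ≤ ε) → ∀ s : Finset (G × G),
      ∑ p ∈ s, N.c p.1 p.2 * (((f n : G → ℝ) - U) p.1 - ((f n : G → ℝ) - U) p.2) *
        (((f n : G → ℝ) - U) p.1 - ((f n : G → ℝ) - U) p.2) ≤ 2 * ε ^ 2 := by
    intro n ε hε s
    have hlim : Filter.Tendsto (fun m => ∑ p ∈ s, N.c p.1 p.2 * N.grad (a n - a m) p *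
        N.grad (a n - a m) p) Filter.atTop (nhds (∑ p ∈ s, N.c p.1 p.2 *
          (((f n : G → ℝ) - U) p.1 - ((f n : G → ℝ) - U) p.2) *
          (((f n : G → ℝ) - U) p.1 - ((f n : G → ℝ) - U) p.2))) := by
      refine tendsto_finsetSum s fun p _ => ?_
      have h1 : Filter.Tendsto (fun m => N.grad (a n - a m) p) Filter.atTop
          (nhds (((f n : G → ℝ) - U) p.1 - ((f n : G → ℝ) - U) p.2)) := by
        have := (hUp p).const_sub (N.grad (a n) p)
        simp only [map_sub, Pi.sub_apply]
        convert this using 2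
        rw [← hf n]
        simp only [grad_toHE]
        ring
      exact (h1.const_mul _).mul h1
    refine le_of_tendsto hlim (Filter.eventually_atTop.2 ⟨n, fun m hm => ?_⟩)
    refine (N.sum_le_norm_sq _ s).trans ?_
    have := hε m hm
    gcongr
  have hmem : ∀ n (ε : ℝ), (∀ m ≥ n, ‖a n - a m‖ ≤ ε) → (f n : G → ℝ) - U ∈ N.domEnergy := by
    intro n ε hε
    refine summable_of_sum_le (c := 2 * ε ^ 2) (fun p => ?_) (key n ε hε)
    simp only [Pi.zero_apply]
    rw [mul_assoc]
    exact mul_nonneg (N.nonneg _ _) (mul_self_nonneg _)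
  have hC : ∀ ε > 0, ∃ K, ∀ n ≥ K, ∀ m ≥ n, ‖a n - a m‖ ≤ ε := by
    intro ε hε
    obtain ⟨K, hK⟩ := Metric.cauchySeq_iff.1 ha ε hε
    exact ⟨K, fun n hn m hm => by
      rw [← dist_eq_norm]
      exact (hK n hn m (hn.trans hm)).le⟩
  have hUmem : U ∈ N.domEnergy := by
    obtain ⟨K, hK⟩ := hC 1 one_pos
    have := N.domEnergy.sub_mem (f K).2 (hmem K 1 (hK K le_rfl))
    simpa using this
  refine ⟨N.toHE ⟨U, hUmem⟩, ?_⟩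
  rw [Metric.tendsto_atTop]
  intro ε hε
  obtain ⟨K, hK⟩ := hC (ε / 2) (half_pos hε)
  refine ⟨K, fun n hn => ?_⟩
  have hb : ‖a n - N.toHE ⟨U, hUmem⟩‖ ^ 2 ≤ (ε / 2) ^ 2 := by
    have hs := (N.summable_grad (a n - N.toHE ⟨U, hUmem⟩)
      (a n - N.toHE ⟨U, hUmem⟩)).tsum_le_of_sum_le (a₂ := 2 * (ε / 2) ^ 2) (fun s => by
        refine le_trans (le_of_eq ?_) (key n (ε / 2) (hK n hn) s)
        rw [← hf n, ← map_sub]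
        rfl)
    rw [norm_sq_eq]
    linarith
  rw [dist_eq_norm]
  have := abs_le_of_sq_le_sq' hb (by positivity)
  linarith [this.2]

/-- The functional `u ↦ u x - u o` on the energy space. -/
def evalDiff (o x : G) : N.HE →L[ℝ] ℝ :=
  LinearMap.mkContinuousOfExistsBound ((LinearMap.proj (x, o)).comp N.grad)
    (N.exists_grad_bound x o)

/-- The energy kernel: `v_x` is the element of the energy space that represents the functional
`u ↦ u x - u o`. -/
def energyKernel (o x : G) : N.HE :=
  (InnerProductSpace.toDual ℝ N.HE).symm (N.evalDiff o x)

theorem inner_energyKernel (o x : G) (u : N.domEnergy) :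
    inner ℝ (N.energyKernel o x) (N.toHE u) = (u : G → ℝ) x - (u : G → ℝ) o := by
  rw [energyKernel, InnerProductSpace.toDual_symm_apply]
  rfl

/-- The pointwise Laplacian of an element of the energy space; it does not depend on the
representative. -/
def lapHE : N.HE →ₗ[ℝ] (G → ℝ) :=
  N.constants.liftQ (N.lap.comp N.domEnergy.subtype) (by
    intro u hu
    obtain ⟨k, hk⟩ := N.mem_constants.1 hu
    rw [LinearMap.mem_ker]
    ext x
    simp [lap_apply, hk])

@[simp] theorem lapHE_toHE (u : N.domEnergy) : N.lapHE (N.toHE u) = N.lap u := rfl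

/-- The harmonic functions of finite energy. -/
def Harm : Submodule ℝ N.HE := LinearMap.ker N.lapHE

/-! ### Dirac masses and the inclusion operator -/

open Classical in
/-- The Dirac mass at `x`, as a function. -/
def diracFun (x : G) : G → ℝ := Pi.single x 1

theorem diracFun_support (x : G) : (diracFun x).support.Finite :=
  (Set.finite_singleton x).subset (by
    classical
    exact Pi.support_single_subset)

end Network

/-- The Hilbert space `ℓ²(G)` (unweighted) of real square-summable functions. -/
abbrev EllTwo (G : Type*) : Type _ := lp (fun _ : G => ℝ) 2

namespace Network

variable {G : Type*} (N : Network G)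

/-- The Dirac mass at `x` in the energy space. -/
def diracHE (x : G) : N.HE :=
  N.toHE ⟨diracFun x, N.mem_domEnergy_of_finite_support (diracFun_support x)⟩

/-- A function with finite support is square-summable. -/
theorem memEllTwo {u : G → ℝ} (hu : u.support.Finite) : Memℓp u 2 := by
  refine memℓp_gen (summable_of_hasFiniteSupport (hu.subset fun x hx => ?_))
  intro h
  simp [h] at hx

/-- The Dirac mass at `x` in `ℓ²(G)`. -/
def diracL2 (x : G) : EllTwo G := ⟨diracFun x, memEllTwo (diracFun_support x)⟩

/-- The finite linear combinations of Dirac masses in `ℓ²(G)`. -/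
def finL2 (G : Type*) : Submodule ℝ (EllTwo G) := Submodule.span ℝ (Set.range diracL2)

theorem finL2_support {f : EllTwo G} (hf : f ∈ finL2 G) : (f : G → ℝ).support.Finite := by
  induction hf using Submodule.span_induction with
  | mem f h =>
    obtain ⟨x, rfl⟩ := h
    exact diracFun_support x
  | zero => exact Set.finite_empty.subset fun x hx => hx rfl
  | add f g _ _ hf hg => exact (hf.union hg).subset (Function.support_add _ _)
  | smul r f _ hf => exact hf.subset (Function.support_const_smul_subset r _)

/-- The inclusion operator `δ_x ↦ δ_x` from `span {δ_x} ⊆ ℓ²(G)` into the energy space: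
it sends a finitely supported function to its class. -/
def inclusion : EllTwo G →ₗ.[ℝ] N.HE where
  domain := finL2 G
  toFun :=
    { toFun := fun f => N.toHE ⟨f.1, N.mem_domEnergy_of_finite_support (finL2_support f.2)⟩
      map_add' := fun f g => by
        rw [← map_add]
        rfl
      map_smul' := fun r f => by
        rw [RingHom.id_apply, ← map_smul]
        rfl }

theorem inclusion_dirac (x : G) :
    N.inclusion ⟨diracL2 x, Submodule.subset_span ⟨x, rfl⟩⟩ = N.diracHE x := rfl

/-- The operator `J`: the closure of the inclusion operator. -/
def J : EllTwo G →ₗ.[ℝ] N.HE := N.inclusion.closure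

/-! ### The Laplacian on `ℓ²(G)` -/

/-- The pointwise Laplacian on `span {δ_x} ⊆ ℓ²(G)`. -/
def lapL2Core : EllTwo G →ₗ.[ℝ] EllTwo G where
  domain := finL2 G
  toFun :=
    { toFun := fun f => ⟨N.lap f.1, memEllTwo (N.lap_support_finite (finL2_support f.2))⟩
      map_add' := fun f g => by
        ext x
        exact congrFun (N.lap.map_add f.1 g.1) x
      map_smul' := fun r f => by
        ext x
        exact congrFun (N.lap.map_smul r f.1) x }

/-- The `ℓ²` Laplacian: the closure of the pointwise Laplacian on `span {δ_x}`. -/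
def lapL2 : EllTwo G →ₗ.[ℝ] EllTwo G := N.lapL2Core.closure

/-! ### The Laplacian on the energy space -/

/-- The Dirac masses represent the pointwise Laplacian: `⟨δ_x, u⟩ = (Δ u)(x)`. -/
theorem inner_diracHE (x : G) (u : N.HE) : inner ℝ (N.diracHE x) u = N.lapHE u x := by
  classical
  obtain ⟨u, rfl⟩ := N.toHE_surjective u
  rw [diracHE, inner_toHE, lapHE_toHE, lap_apply, energy]
  have hA : ∀ g : G → ℝ, ∑' y, N.c x y * g y = ∑ y ∈ N.nbrs x, N.c x y * g y := fun g =>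
    tsum_eq_sum fun y hy => by rw [N.c_eq_zero hy, zero_mul]
  have hsA : ∀ g : G → ℝ, Summable fun y => N.c x y * g y := fun g =>
    summable_of_ne_finset_zero (s := N.nbrs x) fun y hy => by rw [N.c_eq_zero hy, zero_mul]
  let F : G × G → ℝ := fun p => if p.1 = x then N.c p.1 p.2 * ((u : G → ℝ) x - u.1 p.2) else 0
  let F' : G × G → ℝ := fun p => if p.2 = x then N.c p.1 p.2 * ((u : G → ℝ) x - u.1 p.1) else 0
  have i1 : Function.Injective fun y : G => (x, y) := fun a b h => (Prod.ext_iff.1 h).2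
  have i2 : Function.Injective fun y : G => (y, x) := fun a b h => (Prod.ext_iff.1 h).1
  have hF1 : HasSum F (∑ y ∈ N.nbrs x, N.c x y * ((u : G → ℝ) x - u.1 y)) := by
    refine (i1.hasSum_iff ?_).1 ?_
    · rintro ⟨a, b⟩ h
      refine if_neg fun h' => h ⟨b, ?_⟩
      exact Prod.ext h'.symm rfl
    · rw [← hA fun y => (u : G → ℝ) x - u.1 y]
      convert (hsA fun y => (u : G → ℝ) x - u.1 y).hasSum using 1
      ext y
      simp [F]
  have hF2 : HasSum F' (∑ y ∈ N.nbrs x, N.c x y * ((u : G → ℝ) x - u.1 y)) := by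
    refine (i2.hasSum_iff ?_).1 ?_
    · rintro ⟨a, b⟩ h
      refine if_neg fun h' => h ⟨a, ?_⟩
      exact Prod.ext rfl h'.symm
    · rw [← hA fun y => (u : G → ℝ) x - u.1 y]
      convert (hsA fun y => (u : G → ℝ) x - u.1 y).hasSum using 1
      ext y
      simp [F', N.symm y x]
  have hsum := hF1.add hF2
  have htot : ∑' p : G × G, N.c p.1 p.2 * (diracFun x p.1 - diracFun x p.2) *
      ((u : G → ℝ) p.1 - u.1 p.2) = ∑ y ∈ N.nbrs x, N.c x y * ((u : G → ℝ) x - u.1 y) +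
        ∑ y ∈ N.nbrs x, N.c x y * ((u : G → ℝ) x - u.1 y) := by
    refine HasSum.tsum_eq ?_
    convert hsum using 1
    ext ⟨a, b⟩
    simp only [F, F', diracFun, Pi.single_apply]
    by_cases ha : a = x <;> by_cases hb : b = x <;> simp [ha, hb]
    ring
  rw [htot]
  ring

/-- The energy kernel consists of dipoles: `Δ v_x = δ_x - δ_o` pointwise. -/
theorem lapHE_energyKernel (o x : G) :
    N.lapHE (N.energyKernel o x) = diracFun x - diracFun o := by
  classical
  ext y
  rw [← inner_diracHE, real_inner_comm, diracHE, inner_energyKernel]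
  simp only [diracFun, Pi.sub_apply, Pi.single_apply]
  simp [eq_comm]

/-- `w` is the energy-minimizing monopole at `x`: `Δ w = δ_x` pointwise, with the least energy
among all such elements of the energy space. -/
def IsMinMonopole (x : G) (w : N.HE) : Prop :=
  N.lapHE w = diracFun x ∧ ∀ w' : N.HE, N.lapHE w' = diracFun x → ‖w‖ ≤ ‖w'‖

/-- The initial domain of the energy Laplacian: the span of the energy kernel and of the
energy-minimizing monopole `w_o`, if there is one.  On a network with monopoles (a transient
network) this is the span of the monopoles `w_x = w_o + v_x`, see
`energyCoreDomain_eq_span_monopoles`; on the other networks it is the span of the `v_x`. -/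
def energyCoreDomain (o : G) : Submodule ℝ N.HE :=
  Submodule.span ℝ (Set.range (N.energyKernel o) ∪ {w | N.IsMinMonopole o w})

theorem IsMinMonopole.unique {x : G} {w w' : N.HE} (hw : N.IsMinMonopole x w)
    (hw' : N.IsMinMonopole x w') : w' = w := by
  have hn : ‖w'‖ = ‖w‖ := le_antisymm (hw'.2 w hw.1) (hw.2 w' hw'.1)
  have hmid : N.lapHE ((1 / 2 : ℝ) • (w' + w)) = diracFun x := by
    rw [map_smul, map_add, hw.1, hw'.1, ← two_smul ℝ (diracFun x), smul_smul]
    norm_num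
  have h1 := hw.2 _ hmid
  rw [norm_smul, Real.norm_of_nonneg (by norm_num)] at h1
  have h2 := parallelogram_law_with_norm ℝ w' w
  have h3 : ‖w' - w‖ = 0 := by
    rw [hn] at h2
    nlinarith [norm_nonneg w, norm_nonneg (w' + w), mul_self_nonneg ‖w' - w‖]
  exact sub_eq_zero.1 (norm_eq_zero.1 h3)

theorem energyCoreDomain_eq_span_monopoles (o : G) {w : N.HE} (hw : N.IsMinMonopole o w) :
    N.energyCoreDomain o = Submodule.span ℝ (Set.range fun x => w + N.energyKernel o x) := by
  have hv : N.energyKernel o o = 0 := by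
    refine ext_inner_right ℝ fun u => ?_
    obtain ⟨u, rfl⟩ := N.toHE_surjective u
    rw [inner_energyKernel, sub_self, inner_zero_left]
  have hwm : w ∈ Submodule.span ℝ (Set.range fun x => w + N.energyKernel o x) :=
    Submodule.subset_span ⟨o, by simp [hv]⟩
  apply le_antisymm
  · refine Submodule.span_le.2 ?_
    rintro u (⟨x, rfl⟩ | hu)
    · have h : w + N.energyKernel o x ∈
          Submodule.span ℝ (Set.range fun x => w + N.energyKernel o x) :=
        Submodule.subset_span ⟨x, rfl⟩
      simpa using Submodule.sub_mem _ h hwm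
    · rw [IsMinMonopole.unique N hw hu]
      exact hwm
  · refine Submodule.span_le.2 ?_
    rintro u ⟨x, rfl⟩
    exact Submodule.add_mem _ (Submodule.subset_span (Or.inr hw))
      (Submodule.subset_span (Or.inl ⟨x, rfl⟩))

/-- The pointwise Laplacian in the energy space on its maximal domain: the `u` for which the
function `Δ u` has finite energy. -/
def lapEMax : N.HE →ₗ.[ℝ] N.HE where
  domain := N.domEnergy.comap N.lapHE
  toFun := N.toHE.comp ((N.lapHE.comp (Submodule.subtype _)).codRestrict N.domEnergy
    fun u => u.2)

/-- The pointwise Laplacian on the span of the energy kernel and the monopoles. -/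
def lapECore (o : G) : N.HE →ₗ.[ℝ] N.HE := N.lapEMax.domRestrict (N.energyCoreDomain o)

theorem lapECore_domain (o : G) : (N.lapECore o).domain = N.energyCoreDomain o := by
  refine inf_eq_left.2 (Submodule.span_le.2 ?_)
  rintro u (⟨x, rfl⟩ | hu)
  · change N.lapHE _ ∈ N.domEnergy
    rw [lapHE_energyKernel]
    exact N.domEnergy.sub_mem (N.mem_domEnergy_of_finite_support (diracFun_support x))
      (N.mem_domEnergy_of_finite_support (diracFun_support o))
  · change N.lapHE _ ∈ N.domEnergy
    rw [hu.1]
    exact N.mem_domEnergy_of_finite_support (diracFun_support o)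

/-- The energy Laplacian: the closure of the pointwise Laplacian on the span of the energy
kernel and the monopoles. -/
def lapE (o : G) : N.HE →ₗ.[ℝ] N.HE := (N.lapECore o).closure

end Network

end

/-! Everything rests on the identity ⟨δ_x, u⟩ = (Δu)(x) in the energy space: it makes `J†` the
pointwise Laplacian with maximal domain {u : Δu ∈ ℓ²} (`mem_graph_J_adjoint`). By von Neumann's
argument (`IsClosed.exists_graph_decomposition`), `J†J` and `JJ†` are non-negative and self-adjoint,
and on the initial domains they act as Δ.

For (i), equality with the closure amounts to density of the range of 1 + Δ on finitely supported
functions. A vector orthogonal to that range is a solution of g + Δg = 0 in ℓ², and the maximum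
principle excludes a nonzero one.

For (ii), harmonic vectors are killed by `J†`, hence by `JJ†`. Conversely, if u is in the kernel of
the adjoint, testing against the dipoles v_x only shows that Δu is constant. A nonzero constant
would bound evaluation at o in energy on finitely supported functions (`exists_eval_bound`), so by
Riesz a monopole exists; it then lies in the core, and testing against it makes the constant zero.

Minimality is a comparison of quadratic forms. If T is a non-negative self-adjoint extension and w ∈
dom T, Cauchy–Schwarz for the form of T bounds ⟨w, Δz⟩ by ⟨w, Tw⟩^(1/2) ‖J†z‖ on the core. Riesz
then gives Δw ∈ ℓ² up to an additive constant, which is again removed by a monopole (or, on a finite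
network, by ∑ Δw = 0). Thus w ∈ dom `J†` and ‖J†w‖² ≤ ⟨w, Tw⟩, which orders the resolvents. -/

namespace LinearPMap

/-! ### Unbounded operators: products with the adjoint, closures, forms -/

section Composition

variable {E F K : Type*} [AddCommGroup E] [Module ℝ E] [AddCommGroup F] [Module ℝ F]
  [AddCommGroup K] [Module ℝ K]

theorem natComp_apply (g : F →ₗ.[ℝ] K) (f : E →ₗ.[ℝ] F) (x : (g.natComp f).domain)
    (h : (x : E) ∈ f.domain) (h' : f ⟨x, h⟩ ∈ g.domain) :
    g.natComp f x = g ⟨f ⟨x, h⟩, h'⟩ := rfl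

end Composition

variable {E F : Type*} [NormedAddCommGroup E] [InnerProductSpace ℝ E]
  [NormedAddCommGroup F] [InnerProductSpace ℝ F]

theorem _root_.IsSelfAdjoint.isFormalAdjoint [CompleteSpace E] {A : E →ₗ.[ℝ] E}
    (hA : IsSelfAdjoint A) : A.IsFormalAdjoint A := by
  have h := adjoint_isFormalAdjoint hA.dense_domain
  rwa [isSelfAdjoint_def.1 hA] at h

/-- `1 + A` is injective for a non-negative operator `A`. -/
theorem IsNonneg.eq_of_add_eq {A : E →ₗ.[ℝ] E} (hA : A.IsNonneg) {u w : A.domain}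
    (h : (u : E) + A u = w + A w) : u = w := by
  have h0 : ((u - w : A.domain) : E) + A (u - w) = 0 := by
    rw [A.map_sub, Submodule.coe_sub, ← sub_eq_zero.2 h]
    abel
  have h1 := hA (u - w)
  have h2 : inner ℝ ((u - w : A.domain) : E) (((u - w : A.domain) : E) + A (u - w)) = 0 := by
    rw [h0, inner_zero_right]
  rw [inner_add_right] at h2
  have h3 : inner ℝ ((u - w : A.domain) : E) ((u - w : A.domain) : E) ≤ 0 := by linarith
  have h4 := real_inner_self_nonpos.1 h3
  exact sub_eq_zero.1 (Subtype.ext h4)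

/-- A symmetric non-negative operator `A` such that `1 + A` is onto is self-adjoint. -/
theorem isSelfAdjoint_of_surjective [CompleteSpace E] {A : E →ₗ.[ℝ] E}
    (hs : A.IsFormalAdjoint A) (hn : A.IsNonneg) (h : ∀ f : E, ∃ u : A.domain, (u : E) + A u = f) :
    IsSelfAdjoint A := by
  have hd : Dense (A.domain : Set E) := by
    rw [Submodule.dense_iff_topologicalClosure_eq_top, Submodule.topologicalClosure_eq_top_iff,
      Submodule.eq_bot_iff]
    intro v hv
    obtain ⟨u, rfl⟩ := h v
    have h1 := (Submodule.mem_orthogonal _ _).1 hv u u.2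
    rw [inner_add_right] at h1
    have h2 := hn u
    have h3 : u = 0 := Subtype.ext (real_inner_self_nonpos.1 (by linarith : inner ℝ (u : E) u ≤ 0))
    rw [h3, A.map_zero, Submodule.coe_zero, add_zero]
  refine isSelfAdjoint_def.2 (eq_of_le_of_domain_eq (hs.le_adjoint hd) ?_).symm
  refine le_antisymm (hs.le_adjoint hd).1 fun y hy => ?_
  -- Solving (1 + A)u = (1 + A†)y makes y - u orthogonal to the range of 1 + A, which is everything;
  -- z is the preimage of y - u itself.
  obtain ⟨u, hu⟩ := h (y + A† ⟨y, hy⟩)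
  obtain ⟨z, hz⟩ := h (y - u)
  have h1 := adjoint_isFormalAdjoint hd ⟨y, hy⟩ z
  have h2 := hs u z
  have h3 : inner ℝ (y - u) (y - u) = 0 := by
    nth_rw 2 [← hz]
    have h4 : inner ℝ ((u : E) + A u) (z : E) = inner ℝ (y + A† ⟨y, hy⟩) (z : E) := by rw [hu]
    simp only [inner_add_left, inner_add_right, inner_sub_left] at h4 ⊢
    linarith
  rw [sub_eq_zero.1 (inner_self_eq_zero.1 h3)]
  exact u.2

/-- The graph of a closed operator `T` and the rotated graph of its adjoint span the product. -/
theorem IsClosed.exists_graph_decomposition [CompleteSpace E] [CompleteSpace F]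
    {T : E →ₗ.[ℝ] F} (hc : T.IsClosed) (hd : Dense (T.domain : Set E)) (a : E) (b : F) :
    ∃ (x : T.domain) (y : T†.domain), (x : E) - T† y = a ∧ T x + (y : F) = b := by
  let Γ : Submodule ℝ (WithLp 2 (E × F)) :=
    T.graph.comap (WithLp.linearEquiv 2 ℝ (E × F)).toLinearMap
  have hΓ : _root_.IsClosed (Γ : Set (WithLp 2 (E × F))) :=
    IsClosed.preimage (WithLp.prod_continuous_ofLp 2 E F) hc
  have : CompleteSpace Γ := hΓ.completeSpace_coe
  let p : WithLp 2 (E × F) := WithLp.toLp 2 (a, b)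
  obtain ⟨x, hx1, hx2⟩ := (mem_graph_iff T).1 (Γ.starProjection_apply_mem p)
  have horth := Γ.sub_starProjection_mem_orthogonal p
  set q := Γ.starProjection p
  have hq1 : q.fst = x := hx1.symm
  have hq2 : q.snd = T x := hx2.symm
  -- The residue (a - x, b - Tx) of the projection is orthogonal to the graph, which says exactly
  -- that T†(b - Tx) = x - a.
  have key : ∀ z : T.domain, inner ℝ ((x : E) - a) (z : E) = inner ℝ (b - T x) (T z) := by
    intro z
    have h := (Submodule.mem_orthogonal _ _).1 horth (WithLp.toLp 2 ((z : E), T z))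
      (T.mem_graph z)
    rw [WithLp.prod_inner_apply] at h
    have h' : inner ℝ (z : E) (a - q.fst) + inner ℝ (T z) (b - q.snd) = 0 := h
    rw [hq1, hq2, real_inner_comm, real_inner_comm (b - T x)] at h'
    rw [← neg_sub a, inner_neg_left]
    linarith
  refine ⟨x, ⟨b - T x, mem_adjoint_domain_of_exists _ ⟨_, key⟩⟩, ?_, add_sub_cancel _ _⟩
  rw [adjoint_apply_eq hd _ key]
  abel

theorem natComp_adjoint_self_inner [CompleteSpace E] {T : E →ₗ.[ℝ] F}
    (hd : Dense (T.domain : Set E)) (u w : (T†.natComp T).domain)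
    (hu : (u : E) ∈ T.domain) (hw : (w : E) ∈ T.domain) :
    inner ℝ (T†.natComp T u) (w : E) = inner ℝ (T ⟨u, hu⟩) (T ⟨w, hw⟩) := by
  obtain ⟨_, hu'⟩ := (mem_domain_natComp _ _ _).1 u.2
  rw [natComp_apply _ _ _ hu hu']
  exact adjoint_isFormalAdjoint hd ⟨T ⟨u, hu⟩, hu'⟩ ⟨w, hw⟩

/-- Here w ranges over the form domain dom `T†` rather than the smaller operator domain; the
comparison with other extensions needs this generality. -/
theorem natComp_self_adjoint_inner [CompleteSpace E] {T : E →ₗ.[ℝ] F}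
    (hd : Dense (T.domain : Set E)) (u : (T.natComp T†).domain) (w : T†.domain)
    (hu : (u : F) ∈ T†.domain) :
    inner ℝ (T.natComp T† u) (w : F) = inner ℝ (T† ⟨u, hu⟩) (T† w) := by
  obtain ⟨_, hu'⟩ := (mem_domain_natComp _ _ _).1 u.2
  rw [natComp_apply _ _ _ hu hu', real_inner_comm, real_inner_comm (T† w)]
  exact (adjoint_isFormalAdjoint hd w ⟨T† ⟨u, hu⟩, hu'⟩).symm

theorem isNonneg_natComp_adjoint_self [CompleteSpace E] {T : E →ₗ.[ℝ] F}
    (hd : Dense (T.domain : Set E)) : (T†.natComp T).IsNonneg := fun u => by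
  obtain ⟨hu, _⟩ := (mem_domain_natComp _ _ _).1 u.2
  rw [real_inner_comm, natComp_adjoint_self_inner hd u u hu hu]
  exact real_inner_self_nonneg

theorem isNonneg_natComp_self_adjoint [CompleteSpace E] {T : E →ₗ.[ℝ] F}
    (hd : Dense (T.domain : Set E)) : (T.natComp T†).IsNonneg := fun u => by
  obtain ⟨hu, _⟩ := (mem_domain_natComp _ _ _).1 u.2
  rw [real_inner_comm, natComp_self_adjoint_inner hd u ⟨u, hu⟩ hu]
  exact real_inner_self_nonneg

/-- `T* T` is self-adjoint for a closed densely defined operator `T`. -/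
theorem IsClosed.isSelfAdjoint_natComp_adjoint_self [CompleteSpace E] [CompleteSpace F]
    {T : E →ₗ.[ℝ] F} (hc : T.IsClosed) (hd : Dense (T.domain : Set E)) :
    IsSelfAdjoint (T†.natComp T) := by
  refine isSelfAdjoint_of_surjective (fun u w => ?_) (isNonneg_natComp_adjoint_self hd) fun f => ?_
  · obtain ⟨hu, _⟩ := (mem_domain_natComp _ _ _).1 u.2
    obtain ⟨hw, _⟩ := (mem_domain_natComp _ _ _).1 w.2
    rw [natComp_adjoint_self_inner hd u w hu hw, real_inner_comm _ (u : E),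
      natComp_adjoint_self_inner hd w u hw hu, real_inner_comm]
  -- Splitting (f, 0) forces y = -Tx, so x + T†Tx = f.
  · obtain ⟨x, y, h1, h2⟩ := hc.exists_graph_decomposition hd f 0
    have hy : (T x) = ((-y : T†.domain) : F) := by
      rw [Submodule.coe_neg, ← add_eq_zero_iff_eq_neg]
      exact h2
    have hm : T x ∈ T†.domain := hy ▸ (-y).2
    refine ⟨⟨x, (mem_domain_natComp _ _ _).2 ⟨x.2, hm⟩⟩, ?_⟩
    rw [natComp_apply _ _ _ x.2 hm, ← h1,
      show (⟨T ⟨(x : E), x.2⟩, hm⟩ : T†.domain) = -y from Subtype.ext hy, map_neg, sub_eq_add_neg]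

/-- `T T*` is self-adjoint for a closed densely defined operator `T`. -/
theorem IsClosed.isSelfAdjoint_natComp_self_adjoint [CompleteSpace E] [CompleteSpace F]
    {T : E →ₗ.[ℝ] F} (hc : T.IsClosed) (hd : Dense (T.domain : Set E)) :
    IsSelfAdjoint (T.natComp T†) := by
  refine isSelfAdjoint_of_surjective (fun u w => ?_) (isNonneg_natComp_self_adjoint hd) fun f => ?_
  · obtain ⟨hu, _⟩ := (mem_domain_natComp _ _ _).1 u.2
    obtain ⟨hw, _⟩ := (mem_domain_natComp _ _ _).1 w.2
    rw [natComp_self_adjoint_inner hd u ⟨w, hw⟩ hu, real_inner_comm _ (u : F),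
      natComp_self_adjoint_inner hd w ⟨u, hu⟩ hw, real_inner_comm]
  -- Splitting (0, f) forces x = T†y, so TT†y + y = f.
  · obtain ⟨x, y, h1, h2⟩ := hc.exists_graph_decomposition hd 0 f
    have hy : T† y = x := (sub_eq_zero.1 h1).symm
    have hm : T† y ∈ T.domain := hy ▸ x.2
    refine ⟨⟨y, (mem_domain_natComp _ _ _).2 ⟨y.2, hm⟩⟩, ?_⟩
    rw [natComp_apply _ _ _ y.2 hm, ← h2,
      show (⟨T† ⟨(y : F), y.2⟩, hm⟩ : T.domain) = x from Subtype.ext hy, add_comm]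

/-- If `B` is a non-negative self-adjoint extension of `S` and the range of `1 + S` is dense,
then `B` is the closure of `S`. -/
theorem closure_eq_of_dense_range [CompleteSpace E] {S B : E →ₗ.[ℝ] E} (hB : IsSelfAdjoint B)
    (hn : B.IsNonneg) (hSB : S ≤ B) (hd : Dense (Set.range fun u : S.domain => (u : E) + S u)) :
    S.closure = B := by
  have hcl : S.IsClosable := hB.isClosed.isClosable.leIsClosable hSB
  have hle : S.closure.graph ≤ B.graph := by
    rw [← hcl.graph_closure_eq_closure_graph]
    exact S.graph.topologicalClosure_minimal (le_graph_of_le hSB) hB.isClosed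
  have : CompleteSpace S.closure.graph := hcl.closure_isClosed.completeSpace_coe
  let φ : S.closure.graph →L[ℝ] E :=
    (ContinuousLinearMap.fst ℝ E E + ContinuousLinearMap.snd ℝ E E).comp
      S.closure.graph.subtypeL
  have hφ : ∀ p, φ p = (p : E × E).1 + (p : E × E).2 := fun p => rfl
  -- Non-negativity gives ‖u + Bu‖² ≥ ‖u‖² + ‖Bu‖². Hence (u, Bu) ↦ u + Bu has closed range on the
  -- complete graph of the closure; the range is also dense, so it is the whole space, and
  -- injectivity of 1 + B then identifies the two graphs.
  have hanti : AntilipschitzWith 1 φ := by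
    refine AddMonoidHomClass.antilipschitz_of_bound φ fun p => ?_
    obtain ⟨u, hu1, hu2⟩ := (mem_graph_iff B).1 (hle p.2)
    rw [NNReal.coe_one, one_mul, hφ, ← hu1, ← hu2]
    have h1 := hn u
    have h2 := norm_add_sq_real (u : E) (B u)
    have h3 : ‖(u : E)‖ ≤ ‖(u : E) + B u‖ :=
      abs_le_of_sq_le_sq' (by nlinarith [sq_nonneg ‖B u‖]) (norm_nonneg _) |>.2
    have h4 : ‖B u‖ ≤ ‖(u : E) + B u‖ :=
      abs_le_of_sq_le_sq' (by nlinarith [sq_nonneg ‖(u : E)‖]) (norm_nonneg _) |>.2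
    rw [Submodule.coe_norm, Prod.norm_def, ← hu1, ← hu2]
    exact max_le h3 h4
  have hrange : Set.range φ = Set.univ := by
    rw [← (hanti.isClosed_range φ.uniformContinuous).closure_eq]
    refine (hd.mono ?_).closure_eq
    rintro _ ⟨u, rfl⟩
    exact ⟨⟨((u : E), S u), le_graph_of_le S.le_closure (S.mem_graph u)⟩, rfl⟩
  refine eq_of_eq_graph (le_antisymm hle fun p hp => ?_)
  obtain ⟨u, hu1, hu2⟩ := (mem_graph_iff B).1 hp
  obtain ⟨q, hq⟩ : (u : E) + B u ∈ Set.range φ := hrange ▸ Set.mem_univ _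
  obtain ⟨w, hw1, hw2⟩ := (mem_graph_iff B).1 (hle q.2)
  rw [hφ, ← hw1, ← hw2] at hq
  have hwu : w = u := hn.eq_of_add_eq hq
  have hpq : p = q := Prod.ext (by rw [← hu1, ← hw1, hwu]) (by rw [← hu2, ← hw2, hwu])
  exact hpq ▸ q.2

/-- The Cauchy–Schwarz inequality for the form of a symmetric non-negative operator. -/
theorem IsNonneg.inner_sq_le {A : E →ₗ.[ℝ] E} (hn : A.IsNonneg) (hs : A.IsFormalAdjoint A)
    (u w : A.domain) :
    inner ℝ (u : E) (A w) ^ 2 ≤ inner ℝ (u : E) (A u) * inner ℝ (w : E) (A w) := by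
  -- The form at u + t w is a non-negative quadratic in t, so its discriminant is at most zero.
  have h : ∀ t : ℝ, 0 ≤ inner ℝ (w : E) (A w) * (t * t) + 2 * inner ℝ (u : E) (A w) * t +
      inner ℝ (u : E) (A u) := by
    intro t
    have h1 := hn (u + t • w)
    have h2 : inner ℝ (w : E) (A u) = inner ℝ (u : E) (A w) := by
      rw [← hs w u, real_inner_comm]
    simp only [map_add, map_smul, Submodule.coe_add, Submodule.coe_smul, inner_add_left,
      inner_add_right, real_inner_smul_left, real_inner_smul_right, h2] at h1
    linarith
  have := discrim_le_zero h
  rw [discrim] at this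
  nlinarith

/-- The pairs satisfying the adjoint relation form the kernel of a continuous functional, so a
closed subspace containing the graph of T contains that of its closure. -/
theorem IsClosable.mem_graph_adjoint_closure [CompleteSpace E] {T : E →ₗ.[ℝ] F}
    (hc : T.IsClosable) (hd : Dense (T.domain : Set E)) {y : F} {x : E}
    (h : ∀ z : T.domain, inner ℝ x (z : E) = inner ℝ y (T z)) :
    (y, x) ∈ T.closure†.graph := by
  have hle : T.closure.graph ≤
      ((innerSL ℝ x).comp (ContinuousLinearMap.fst ℝ E F) -
        (innerSL ℝ y).comp (ContinuousLinearMap.snd ℝ E F)).ker := by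
    rw [← hc.graph_closure_eq_closure_graph]
    refine T.graph.topologicalClosure_minimal (fun p hp => ?_) (ContinuousLinearMap.isClosed_ker _)
    obtain ⟨z, hz1, hz2⟩ := (mem_graph_iff T).1 hp
    rw [LinearMap.mem_ker]
    simp [← hz1, ← hz2, h z]
  have key : ∀ z : T.closure.domain, inner ℝ x (z : E) = inner ℝ y (T.closure z) := fun z => by
    have := LinearMap.mem_ker.1 (hle (T.closure.mem_graph z))
    simpa [sub_eq_zero] using this
  exact (mem_graph_iff _).2 ⟨⟨y, mem_adjoint_domain_of_exists _ ⟨x, key⟩⟩, rfl,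
    adjoint_apply_eq (hd.mono T.le_closure.1) _ key⟩

end LinearPMap

/-- A linear functional that is bounded by `C ‖A v‖` is represented on the range of `A` by a
vector of norm at most `C`. -/
theorem LinearMap.exists_inner_eq_of_bound {V H : Type*} [AddCommGroup V] [Module ℝ V]
    [NormedAddCommGroup H] [InnerProductSpace ℝ H] [CompleteSpace H] (A : V →ₗ[ℝ] H)
    (φ : V →ₗ[ℝ] ℝ) {C : ℝ} (hC : 0 ≤ C) (h : ∀ v, |φ v| ≤ C * ‖A v‖) :
    ∃ w : H, ‖w‖ ≤ C ∧ ∀ v, inner ℝ w (A v) = φ v := by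
  obtain ⟨s, hs⟩ := A.rangeRestrict.exists_rightInverse_of_surjective A.range_rangeRestrict
  have hs' : ∀ p : A.range, A (s p) = p := fun p => congrArg Subtype.val (LinearMap.congr_fun hs p)
  let ψ : StrongDual ℝ A.range := (φ.comp s).mkContinuous C fun p => by
    rw [Real.norm_eq_abs]
    refine (h (s p)).trans_eq ?_
    rw [hs', Submodule.coe_norm]
  obtain ⟨g, hg, hgn⟩ := exists_extension_norm_eq A.range ψ
  refine ⟨(InnerProductSpace.toDual ℝ H).symm g, ?_, fun v => ?_⟩
  · rw [LinearIsometryEquiv.norm_map, hgn]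
    exact LinearMap.mkContinuous_norm_le _ hC _
  · rw [InnerProductSpace.toDual_symm_apply]
    refine (hg ⟨A v, A.mem_range_self v⟩).trans ?_
    change φ (s _) = φ v
    -- The two preimages of Av differ by an element of ker A, where the bound forces φ to vanish.
    have h1 := h (s ⟨A v, A.mem_range_self v⟩ - v)
    rw [_root_.map_sub A, hs', sub_self, norm_zero, mul_zero, _root_.map_sub] at h1
    exact sub_eq_zero.1 (abs_eq_zero.1 (le_antisymm h1 (abs_nonneg _)))

/-! ### Dirac masses, closability of the inclusion, and the adjoint of J -/

namespace EllTwo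

variable {G : Type*}

theorem finite_setOf_le (g : EllTwo G) {ε : ℝ} (hε : 0 < ε) : {x | ε ≤ |g x|}.Finite := by
  have hs := lp.summable_inner (𝕜 := ℝ) g g
  have h := hs.tendsto_cofinite_zero.eventually_lt_const (pow_pos hε 2)
  refine (Filter.eventually_cofinite.1 h).subset fun x hx => ?_
  have hx' : ε ≤ |g x| := hx
  change ¬ inner ℝ (g x) (g x) < ε ^ 2
  rw [real_inner_self_eq_norm_sq, Real.norm_eq_abs, not_lt]
  gcongr

end EllTwo

namespace Network

variable {G : Type*} (N : Network G)

theorem diracFun_apply_comm (x y : G) : diracFun x y = diracFun y x := by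
  classical
  simp only [diracFun, Pi.single_apply, eq_comm]

theorem diracFun_self (x : G) : diracFun x x = 1 := by simp [diracFun]

theorem diracFun_of_ne {x y : G} (h : y ≠ x) : diracFun x y = 0 := by simp [diracFun, h]

theorem eq_sum_diracFun {h : G → ℝ} {s : Finset G} (hs : ∀ x ∉ s, h x = 0) :
    h = ∑ x ∈ s, h x • diracFun x := by
  classical
  ext y
  simp only [diracFun, Finset.sum_apply, Pi.smul_apply, Pi.single_apply, smul_eq_mul, mul_ite,
    mul_one, mul_zero, Finset.sum_ite_eq]
  split_ifs with hy
  · rfl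
  · exact hs y hy

theorem inner_diracL2 (g : EllTwo G) (x : G) : inner ℝ g (diracL2 x) = g x := by
  classical
  rw [lp.inner_eq_tsum, tsum_eq_single x]
  · change inner ℝ (g x) (diracFun x x) = g x
    rw [diracFun_self]
    simp
  · intro y hy
    change inner ℝ (g y) (diracFun x y) = 0
    rw [diracFun_of_ne hy, inner_zero_right]

theorem diracL2_mem (x : G) : diracL2 x ∈ finL2 G := Submodule.subset_span ⟨x, rfl⟩

theorem dense_finL2 : Dense (finL2 G : Set (EllTwo G)) := by
  rw [Submodule.dense_iff_topologicalClosure_eq_top, Submodule.topologicalClosure_eq_top_iff,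
    Submodule.eq_bot_iff]
  intro g hg
  ext x
  have h := (Submodule.mem_orthogonal' _ _).1 hg _ (diracL2_mem x)
  rwa [inner_diracL2] at h

theorem mem_finL2_of_support {f : EllTwo G} (hf : (f : G → ℝ).support.Finite) : f ∈ finL2 G := by
  have h : f = ∑ x ∈ hf.toFinset, f x • diracL2 x := by
    ext y
    have := congrFun (eq_sum_diracFun (h := f) (s := hf.toFinset) (by simp)) y
    rw [this]
    simp only [lp.coeFn_sum, Finset.sum_apply]
    rfl
  rw [h]
  exact Submodule.sum_mem _ fun x _ => Submodule.smul_mem _ _ (diracL2_mem x)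

/-- The inner product with a finitely supported function in the energy space is given by the
Laplacian. -/
theorem inner_toHE_of_support (u : N.HE) (h : N.domEnergy) {s : Finset G}
    (hs : ∀ x ∉ s, (h : G → ℝ) x = 0) :
    inner ℝ u (N.toHE h) = ∑ x ∈ s, (h : G → ℝ) x * N.lapHE u x := by
  have hh : N.toHE h = ∑ x ∈ s, (h : G → ℝ) x • N.diracHE x := by
    simp only [diracHE, ← map_smul, ← map_sum]
    congr 1
    ext y
    rw [congrFun (eq_sum_diracFun hs) y]
    simp
  rw [hh, inner_sum]
  refine Finset.sum_congr rfl fun x _ => ?_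
  rw [real_inner_smul_right, real_inner_comm, inner_diracHE]

theorem inner_inclusion (u : N.HE) (g : EllTwo G) (h : ⇑g = N.lapHE u) (f : N.inclusion.domain) :
    inner ℝ g (f : EllTwo G) = inner ℝ u (N.inclusion f) := by
  have hf := finL2_support f.2
  have hs : ∀ x ∉ hf.toFinset, (f : EllTwo G) x = 0 := by simp
  refine Eq.trans ?_ (N.inner_toHE_of_support u
    ⟨f.1, N.mem_domEnergy_of_finite_support hf⟩ hs).symm
  rw [lp.inner_eq_tsum, tsum_eq_sum (s := hf.toFinset)]
  · refine Finset.sum_congr rfl fun x _ => ?_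
    rw [← h]
    simp
  · intro x hx
    rw [hs x hx, inner_zero_right]

/-- The dipoles suffice: a vector orthogonal to every v_x satisfies u(x) = u(o) for all x, so it is
constant. -/
theorem dense_energyCoreDomain (o : G) : Dense (N.energyCoreDomain o : Set N.HE) := by
  rw [Submodule.dense_iff_topologicalClosure_eq_top, Submodule.topologicalClosure_eq_top_iff,
    Submodule.eq_bot_iff]
  intro u hu
  obtain ⟨u, rfl⟩ := N.toHE_surjective u
  refine N.toHE_eq_zero.2 (N.mem_constants.2 ⟨(u : G → ℝ) o, fun x => ?_⟩)
  have h := (Submodule.mem_orthogonal _ _).1 hu (N.energyKernel o x)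
    (Submodule.subset_span (Or.inl ⟨x, rfl⟩))
  rw [inner_energyKernel] at h
  linarith

theorem lapHE_support_finite {o : G} {u : N.HE} (hu : u ∈ N.energyCoreDomain o) :
    (N.lapHE u).support.Finite := by
  induction hu using Submodule.span_induction with
  | mem u h =>
    rcases h with ⟨x, rfl⟩ | h
    · rw [lapHE_energyKernel]
      exact ((diracFun_support x).union (diracFun_support o)).subset (Function.support_sub _ _)
    · rw [h.1]
      exact diracFun_support o
  | zero => simp
  | add f g _ _ hf hg =>
    rw [map_add]
    exact (hf.union hg).subset (Function.support_add _ _)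
  | smul r f _ hf =>
    rw [map_smul]
    exact hf.subset (Function.support_const_smul_subset r _)

theorem dense_inclusion_domain : Dense (N.inclusion.domain : Set (EllTwo G)) := dense_finL2

/-- The adjoint is densely defined, because its domain contains the energy core, where Δu has finite
support. The inclusion is therefore contained in the closed operator `N.inclusion††`. -/
theorem isClosable_inclusion (o : G) : N.inclusion.IsClosable := by
  have hd : Dense (N.inclusion†.domain : Set N.HE) := by
    refine (N.dense_energyCoreDomain o).mono fun u hu => ?_
    exact LinearPMap.mem_adjoint_domain_of_exists _
      ⟨⟨N.lapHE u, memEllTwo (N.lapHE_support_finite hu)⟩, N.inner_inclusion u _ rfl⟩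
  exact (LinearPMap.adjoint_isClosed hd).isClosable.leIsClosable
    ((LinearPMap.adjoint_isFormalAdjoint N.dense_inclusion_domain).le_adjoint hd)

theorem isClosed_J (o : G) : N.J.IsClosed := (N.isClosable_inclusion o).closure_isClosed

theorem inclusion_le_J : N.inclusion ≤ N.J := N.inclusion.le_closure

theorem dense_J_domain : Dense (N.J.domain : Set (EllTwo G)) :=
  N.dense_inclusion_domain.mono N.inclusion_le_J.1

theorem mem_J_domain {f : EllTwo G} (hf : f ∈ finL2 G) : f ∈ N.J.domain := N.inclusion_le_J.1 hf

theorem J_apply {f : EllTwo G} (hf : f ∈ finL2 G) (hf' : f ∈ N.J.domain) :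
    N.J ⟨f, hf'⟩ = N.toHE ⟨f, N.mem_domEnergy_of_finite_support (finL2_support hf)⟩ :=
  (N.inclusion_le_J.2 (x := ⟨f, hf⟩) (y := ⟨f, hf'⟩) rfl).symm

/-- The adjoint of `J` is the pointwise Laplacian on its maximal domain. -/
theorem mem_graph_J_adjoint (o : G) {u : N.HE} {g : EllTwo G} :
    (u, g) ∈ N.J†.graph ↔ ⇑g = N.lapHE u := by
  constructor
  · intro h
    obtain ⟨v, hv, hg⟩ := (LinearPMap.mem_graph_iff _).1 h
    obtain rfl : (v : N.HE) = u := hv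
    ext x
    have h1 := LinearPMap.adjoint_isFormalAdjoint N.dense_J_domain v
      ⟨diracL2 x, N.mem_J_domain (diracL2_mem x)⟩
    rw [J_apply _ (diracL2_mem x), inner_diracL2, hg] at h1
    refine h1.trans ?_
    rw [real_inner_comm, ← inner_diracHE]
    rfl
  · exact fun h => (N.isClosable_inclusion o).mem_graph_adjoint_closure N.dense_inclusion_domain
      (N.inner_inclusion u g h)

theorem mem_J_adjoint_domain (o : G) {u : N.HE} {g : EllTwo G} (h : ⇑g = N.lapHE u) :
    u ∈ N.J†.domain := LinearPMap.mem_domain_of_mem_graph ((N.mem_graph_J_adjoint o).2 h)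

theorem J_adjoint_apply (o : G) {u : N.HE} {g : EllTwo G} (h : ⇑g = N.lapHE u)
    (hu : u ∈ N.J†.domain) : N.J† ⟨u, hu⟩ = g :=
  ((LinearPMap.image_iff hu).2 ((N.mem_graph_J_adjoint o).2 h)).symm

theorem coe_J_adjoint (o : G) (u : N.J†.domain) : ⇑(N.J† u) = N.lapHE u :=
  (N.mem_graph_J_adjoint o).1 (N.J†.mem_graph u)

/-! ### Essential self-adjointness of the Laplacian on ℓ² -/

theorem lapL2Core_le (o : G) : N.lapL2Core ≤ N.J†.natComp N.J := by
  have key : ∀ f : N.lapL2Core.domain, ∃ hf : (f : EllTwo G) ∈ N.J.domain,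
      ∃ hf' : N.J ⟨f, hf⟩ ∈ N.J†.domain, N.J† ⟨N.J ⟨f, hf⟩, hf'⟩ = N.lapL2Core f := by
    intro f
    have hf := N.mem_J_domain f.2
    have h : ⇑(N.lapL2Core f) = N.lapHE (N.J ⟨f, hf⟩) := by
      rw [J_apply _ f.2]
      rfl
    exact ⟨hf, N.mem_J_adjoint_domain o h, N.J_adjoint_apply o h _⟩
  refine ⟨fun f hf => ?_, fun f u hfu => ?_⟩
  · obtain ⟨h1, h2, _⟩ := key ⟨f, hf⟩
    exact (LinearPMap.mem_domain_natComp _ _ _).2 ⟨h1, h2⟩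
  · obtain ⟨u, hu⟩ := u
    obtain rfl : (f : EllTwo G) = u := hfu
    obtain ⟨h1, h2, h3⟩ := key f
    rw [LinearPMap.natComp_apply _ _ _ h1 h2, h3]

theorem lap_diracFun (x y : G) :
    N.lap (diracFun x) y = ∑ z ∈ N.nbrs x, N.c x z * (diracFun x y - diracFun z y) := by
  have h : N.lap (diracFun x) y = N.lap (diracFun y) x := by
    have h1 := N.inner_diracHE y (N.diracHE x)
    rw [real_inner_comm, inner_diracHE] at h1
    exact h1.symm
  rw [h, lap_apply]
  exact Finset.sum_congr rfl fun z _ => by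
    rw [diracFun_apply_comm y x, diracFun_apply_comm y z]

/-- Local finiteness makes Δδ_x a finite combination of Dirac masses, so Δ can be moved onto any g
in ℓ² without asking that Δg be in ℓ². -/
theorem inner_lapL2Core_diracL2 (g : EllTwo G) (x : G) :
    inner ℝ g (N.lapL2Core ⟨diracL2 x, diracL2_mem x⟩) = N.lap g x := by
  have h : N.lapL2Core ⟨diracL2 x, diracL2_mem x⟩ =
      ∑ z ∈ N.nbrs x, N.c x z • (diracL2 x - diracL2 z) := by
    ext y
    refine (N.lap_diracFun x y).trans ?_
    simp only [lp.coeFn_sum, Finset.sum_apply]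
    rfl
  rw [h, inner_sum, lap_apply]
  refine Finset.sum_congr rfl fun z _ => ?_
  rw [real_inner_smul_right, inner_sub_right, inner_diracL2, inner_diracL2]

/-- By the maximum principle `-1` is not an eigenvalue of the Laplacian in `ℓ²`. -/
theorem eq_zero_of_lap_eq_neg (g : EllTwo G) (h : ∀ x, g x + N.lap g x = 0) : g = 0 := by
  by_contra hg
  obtain ⟨a, ha⟩ : ∃ a, g a ≠ 0 := by
    by_contra hcon
    push Not at hcon
    exact hg (by ext x; exact hcon x)
  -- Square-summability makes this superlevel set finite, so |g| attains its maximum. There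
  -- g(x)Δg(x) ≥ 0 term by term, contradicting g(x)² + g(x)Δg(x) = 0.
  obtain ⟨x, hx, hmax⟩ := Set.exists_max_image {x | |g a| ≤ |g x|} (fun x => |g x|)
    (g.finite_setOf_le (abs_pos.2 ha)) ⟨a, (le_rfl : |g a| ≤ |g a|)⟩
  have hmax' : ∀ y, |g y| ≤ |g x| := fun y => by
    rcases le_total |g a| |g y| with h | h
    · exact hmax y h
    · exact h.trans hx
  have hpos : 0 < g x * g x := by
    have : 0 < |g x| := (abs_pos.2 ha).trans_le hx
    rw [← abs_mul_abs_self]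
    positivity
  have h1 : 0 ≤ g x * N.lap g x := by
    rw [lap_apply, Finset.mul_sum]
    refine Finset.sum_nonneg fun y _ => ?_
    have h2 : g x * g y ≤ g x * g x := by
      rw [← abs_mul_abs_self (g x)]
      refine (le_abs_self _).trans ?_
      rw [abs_mul]
      exact mul_le_mul_of_nonneg_left (hmax' y) (abs_nonneg _)
    have : g x * (N.c x y * (g x - g y)) = N.c x y * (g x * g x - g x * g y) := by ring
    rw [this]
    exact mul_nonneg (N.nonneg _ _) (sub_nonneg.2 h2)
  have h3 := congrArg (g x * ·) (h x)
  simp only [mul_add, mul_zero] at h3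
  linarith

theorem dense_range_add_lapL2Core :
    Dense (Set.range fun f : N.lapL2Core.domain => (f : EllTwo G) + N.lapL2Core f) := by
  let φ : N.lapL2Core.domain →ₗ[ℝ] EllTwo G := N.lapL2Core.domain.subtype + N.lapL2Core.toFun
  change Dense (φ.range : Set (EllTwo G))
  rw [Submodule.dense_iff_topologicalClosure_eq_top, Submodule.topologicalClosure_eq_top_iff,
    Submodule.eq_bot_iff]
  intro g hg
  refine N.eq_zero_of_lap_eq_neg g fun x => ?_
  have h := (Submodule.mem_orthogonal' _ _).1 hg _ (φ.mem_range_self ⟨diracL2 x, diracL2_mem x⟩)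
  have h' : inner ℝ g (diracL2 x + N.lapL2Core ⟨diracL2 x, diracL2_mem x⟩) = 0 := h
  rwa [inner_add_right, inner_diracL2, inner_lapL2Core_diracL2] at h'

theorem isSelfAdjoint_J_adjoint_J (o : G) : IsSelfAdjoint (N.J†.natComp N.J) :=
  (N.isClosed_J o).isSelfAdjoint_natComp_adjoint_self N.dense_J_domain

theorem isSelfAdjoint_J_J_adjoint (o : G) : IsSelfAdjoint (N.J.natComp N.J†) :=
  (N.isClosed_J o).isSelfAdjoint_natComp_self_adjoint N.dense_J_domain

theorem lapL2_eq (o : G) : N.lapL2 = N.J†.natComp N.J :=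
  LinearPMap.closure_eq_of_dense_range (N.isSelfAdjoint_J_adjoint_J o)
    (LinearPMap.isNonneg_natComp_adjoint_self N.dense_J_domain) (N.lapL2Core_le o)
    N.dense_range_add_lapL2Core

end Network

/-! ### Criteria for the existence of a monopole -/

namespace Network

variable {G : Type*} (N : Network G)

theorem abs_energy_term_le (f : G → ℝ) (p : G × G) :
    N.c p.1 p.2 * (|f p.1| - |f p.2|) * (|f p.1| - |f p.2|) ≤
      N.c p.1 p.2 * (f p.1 - f p.2) * (f p.1 - f p.2) := by
  rw [mul_assoc, mul_assoc]
  refine mul_le_mul_of_nonneg_left ?_ (N.nonneg _ _)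
  rw [← abs_mul_abs_self, ← abs_mul_abs_self (f p.1 - f p.2)]
  have := abs_abs_sub_abs_le (f p.1) (f p.2)
  gcongr

theorem abs_mem_domEnergy (f : N.domEnergy) : (fun x => |(f : G → ℝ) x|) ∈ N.domEnergy := by
  refine Summable.of_nonneg_of_le (fun p => ?_) (N.abs_energy_term_le f) f.2
  rw [mul_assoc]
  exact mul_nonneg (N.nonneg _ _) (mul_self_nonneg _)

theorem norm_toHE_abs_le (f : N.domEnergy) :
    ‖N.toHE ⟨fun x => |(f : G → ℝ) x|, N.abs_mem_domEnergy f⟩‖ ≤ ‖N.toHE f‖ := by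
  refine abs_le_of_sq_le_sq' ?_ (norm_nonneg _) |>.2
  rw [norm_sq_eq, norm_sq_eq]
  refine mul_le_mul_of_nonneg_left ?_ (by norm_num)
  exact (N.summable_grad _ _).tsum_le_tsum (N.abs_energy_term_le f) (N.summable_grad _ _)

/-- If the Laplacian of some element of the energy space has a positive sum over a finite set and
is non-negative off that set, then evaluation at `o` is bounded in energy on finitely supported
functions. -/
theorem exists_eval_bound (o : G) (w : N.HE) (B : Finset G) (hB : ∀ x ∉ B, 0 ≤ N.lapHE w x)
    (hpos : 0 < ∑ x ∈ B, N.lapHE w x) :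
    ∃ C : ℝ, 0 ≤ C ∧ ∀ f : N.inclusion.domain, |(f : EllTwo G) o| ≤ C * ‖N.inclusion f‖ := by
  classical
  choose C hC using fun x => N.exists_grad_bound x o
  -- With a = |f|, the sum of a·Δw over B is at most ⟨w, a⟩ ≤ ‖w‖‖a‖. Replacing a(x) by a(o) on B
  -- costs at most C x ‖a‖ per unit of |Δw(x)|; solving for a(o) gives this constant. The outer
  -- absolute value is there since the C x carry no sign.
  refine ⟨|(‖w‖ + ∑ x ∈ B, C x * |N.lapHE w x|) / ∑ x ∈ B, N.lapHE w x|, abs_nonneg _,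
    fun f => ?_⟩
  have hfin := finL2_support f.2
  let F : N.domEnergy := ⟨f.1, N.mem_domEnergy_of_finite_support hfin⟩
  let a : N.domEnergy := ⟨fun x => |(f : EllTwo G) x|, N.abs_mem_domEnergy F⟩
  have hle : ‖N.toHE a‖ ≤ ‖N.inclusion f‖ := N.norm_toHE_abs_le F
  have hsupp : ∀ x ∉ hfin.toFinset ∪ B, (a : G → ℝ) x = 0 := by
    intro x hx
    simp only [Finset.mem_union, Set.Finite.mem_toFinset, Function.mem_support, not_or,
      not_not] at hx
    change |(f : EllTwo G) x| = 0
    rw [hx.1, abs_zero]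
  have h1 := N.inner_toHE_of_support w a hsupp
  have h2 : ∑ x ∈ B, (a : G → ℝ) x * N.lapHE w x ≤ ‖w‖ * ‖N.toHE a‖ := by
    refine le_trans ?_ (real_inner_le_norm w (N.toHE a))
    rw [h1]
    -- Terms off B can be dropped only because a ≥ 0; hence the passage from f to |f|, which does
    -- not increase energy.
    exact Finset.sum_le_sum_of_subset_of_nonneg Finset.subset_union_right fun x _ hx =>
      mul_nonneg (abs_nonneg _) (hB x hx)
  have h3 : ∀ x, (a : G → ℝ) o * N.lapHE w x - C x * |N.lapHE w x| * ‖N.toHE a‖ ≤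
      (a : G → ℝ) x * N.lapHE w x := by
    intro x
    have h4 := hC x (N.toHE a)
    rw [grad_toHE] at h4
    have h5 := mul_le_mul_of_nonneg_right h4 (abs_nonneg (N.lapHE w x))
    rw [← abs_mul] at h5
    have h6 := (abs_le.1 h5).1
    simp only at h6
    linarith
  have h7 := (Finset.sum_le_sum fun x (_ : x ∈ B) => h3 x).trans h2
  rw [Finset.sum_sub_distrib, ← Finset.mul_sum, ← Finset.sum_mul] at h7
  have h8 : |(f : EllTwo G) o| ≤
      (‖w‖ + ∑ x ∈ B, C x * |N.lapHE w x|) / (∑ x ∈ B, N.lapHE w x) * ‖N.toHE a‖ := by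
    rw [div_mul_eq_mul_div, le_div_iff₀ hpos]
    have : (a : G → ℝ) o = |(f : EllTwo G) o| := rfl
    rw [this] at h7
    linarith
  refine h8.trans (mul_le_mul (le_abs_self _) hle (norm_nonneg _) (abs_nonneg _))

/-- If there is a monopole then there is one of least energy. -/
theorem exists_isMinMonopole_of_monopole {o : G} {w : N.HE} (hw : N.lapHE w = diracFun o) :
    ∃ w, N.IsMinMonopole o w := by
  let K : Submodule ℝ N.HE := (Submodule.span ℝ (Set.range N.diracHE)).topologicalClosure
  have : CompleteSpace K :=
    (Submodule.isClosed_topologicalClosure _).completeSpace_coe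
  have hmem : ∀ x, N.diracHE x ∈ K := fun x =>
    Submodule.le_topologicalClosure _ (Submodule.subset_span ⟨x, rfl⟩)
  have hK : ∀ u : N.HE, u ∈ Kᗮ ↔ N.lapHE u = 0 := by
    intro u
    constructor
    · intro hu
      ext x
      rw [← inner_diracHE]
      exact (Submodule.mem_orthogonal _ _).1 hu _ (hmem x)
    · intro hu
      rw [Submodule.orthogonal_closure, Submodule.mem_orthogonal]
      intro v hv
      induction hv using Submodule.span_induction with
      | mem v h =>
        obtain ⟨x, rfl⟩ := h
        rw [inner_diracHE, hu]
        rfl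
      | zero => exact inner_zero_left _
      | add f g _ _ hf hg => rw [inner_add_left, hf, hg, add_zero]
      | smul r f _ hf => rw [real_inner_smul_left, hf, mul_zero]
  -- The complement of the closed span of the Dirac masses consists of the harmonic vectors, so
  -- projecting removes the harmonic part, leaving Δ unchanged and minimizing the energy.
  have hlap : N.lapHE (K.starProjection w) = diracFun o := by
    have h := (hK _).1 (K.sub_starProjection_mem_orthogonal w)
    rw [map_sub, sub_eq_zero] at h
    rw [← h, hw]
  refine ⟨K.starProjection w, hlap, fun w' hw' => ?_⟩
  have h1 : w' - K.starProjection w ∈ Kᗮ := (hK _).2 (by rw [map_sub, hlap, hw', sub_self])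
  have h2 := (Submodule.mem_orthogonal _ _).1 h1 _ (K.starProjection_apply_mem w)
  have h3 := norm_add_sq_real (K.starProjection w) (w' - K.starProjection w)
  rw [h2, add_sub_cancel] at h3
  exact abs_le_of_sq_le_sq' (by nlinarith [sq_nonneg ‖w' - K.starProjection w‖])
    (norm_nonneg _) |>.2

/-- Riesz representation of f ↦ f(o), which is bounded in energy on finitely supported functions:
testing the representing vector on δ_x shows that it is a monopole. -/
theorem exists_isMinMonopole (o : G) (w : N.HE) (B : Finset G) (hB : ∀ x ∉ B, 0 ≤ N.lapHE w x)
    (hpos : 0 < ∑ x ∈ B, N.lapHE w x) : ∃ w, N.IsMinMonopole o w := by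
  obtain ⟨C, hC, hbound⟩ := N.exists_eval_bound o w B hB hpos
  let φ : N.inclusion.domain →ₗ[ℝ] ℝ :=
    { toFun := fun f => (f : EllTwo G) o
      map_add' := fun f g => rfl
      map_smul' := fun r f => rfl }
  obtain ⟨m, -, hm⟩ := N.inclusion.toFun.exists_inner_eq_of_bound φ hC hbound
  refine N.exists_isMinMonopole_of_monopole (w := m) ?_
  ext x
  rw [← inner_diracHE, real_inner_comm]
  exact (hm ⟨diracL2 x, diracL2_mem x⟩).trans (diracFun_apply_comm x o)

theorem exists_isMinMonopole_of_lapHE_eq_const (o : G) {w : N.HE} {k : ℝ} (hk : k ≠ 0)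
    (hw : ∀ x, N.lapHE w x = k) : ∃ w, N.IsMinMonopole o w := by
  have h : ∀ x, N.lapHE (k⁻¹ • w) x = 1 := fun x => by
    rw [map_smul, Pi.smul_apply, hw, smul_eq_mul, inv_mul_cancel₀ hk]
  exact N.exists_isMinMonopole o (k⁻¹ • w) {o} (fun x _ => by rw [h]; exact zero_le_one)
    (by simp [h])

theorem exists_isMinMonopole_of_lapHE_eq_add_const [Infinite G] (o : G) {w : N.HE} {k : ℝ}
    (hk : k ≠ 0) (g : EllTwo G) (hw : ∀ x, N.lapHE w x = g x + k) :
    ∃ w, N.IsMinMonopole o w := by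
  classical
  have h : ∀ x, N.lapHE (k⁻¹ • w) x = (k⁻¹ • g) x + 1 := fun x => by
    rw [map_smul, Pi.smul_apply, hw, smul_eq_mul, mul_add, inv_mul_cancel₀ hk]
    rfl
  have hfin := (k⁻¹ • g).finite_setOf_le (ε := 1 / 2) (by norm_num)
  have hhalf : ∀ x ∉ hfin.toFinset, 1 / 2 ≤ N.lapHE (k⁻¹ • w) x := by
    intro x hx
    rw [Set.Finite.mem_toFinset] at hx
    have hx' : |(k⁻¹ • g) x| < 1 / 2 := not_le.1 hx
    rw [h]
    linarith [(abs_lt.1 hx').1]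
  set S := ∑ x ∈ hfin.toFinset, N.lapHE (k⁻¹ • w) x
  -- The sum S over the exceptional set may be negative; n further vertices, each contributing at
  -- least 1/2, outweigh it. This is where G must be infinite.
  obtain ⟨n, hn⟩ := exists_nat_gt (2 * |S|)
  obtain ⟨A, hA, hcard⟩ := hfin.infinite_compl.exists_subset_card_eq n
  have hdisj : Disjoint hfin.toFinset A := by
    rw [Finset.disjoint_left]
    intro x hx hxA
    exact hA hxA (hfin.mem_toFinset.1 hx)
  refine N.exists_isMinMonopole o (k⁻¹ • w) (hfin.toFinset ∪ A) (fun x hx => ?_) ?_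
  · rw [Finset.mem_union, not_or] at hx
    exact le_trans (by norm_num) (hhalf x hx.1)
  · rw [Finset.sum_union hdisj]
    have h1 : (n : ℝ) * (1 / 2) ≤ ∑ x ∈ A, N.lapHE (k⁻¹ • w) x := by
      rw [← hcard, ← nsmul_eq_mul]
      exact Finset.card_nsmul_le_sum _ _ _ fun x hx => hhalf x (Finset.disjoint_right.1 hdisj hx)
    have h2 := neg_abs_le S
    linarith

/-! ### The Laplacian on the energy space as a restriction of `J J*` -/

theorem mem_J_adjoint_domain_of_mem_core {o : G} {u : N.HE} (hu : u ∈ N.energyCoreDomain o) :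
    u ∈ N.J†.domain :=
  N.mem_J_adjoint_domain o (g := ⟨N.lapHE u, memEllTwo (N.lapHE_support_finite hu)⟩) rfl

theorem lapECore_le (o : G) : N.lapECore o ≤ N.J.natComp N.J† := by
  have key : ∀ u : (N.lapECore o).domain, ∃ hu : (u : N.HE) ∈ N.J†.domain,
      ∃ hu' : N.J† ⟨u, hu⟩ ∈ N.J.domain, N.J ⟨N.J† ⟨u, hu⟩, hu'⟩ = N.lapECore o u := by
    intro u
    have hmem : (u : N.HE) ∈ N.energyCoreDomain o := (N.lapECore_domain o) ▸ u.2
    have hu := N.mem_J_adjoint_domain_of_mem_core hmem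
    have hfin : N.J† ⟨u, hu⟩ ∈ finL2 G := mem_finL2_of_support (by
      rw [N.coe_J_adjoint o]
      exact N.lapHE_support_finite hmem)
    refine ⟨hu, N.mem_J_domain hfin, ?_⟩
    rw [J_apply _ hfin]
    change N.toHE _ = N.toHE _
    congr 1
    ext x
    exact congrFun (N.coe_J_adjoint o ⟨u, hu⟩) x
  refine ⟨fun f hf => ?_, fun f u hfu => ?_⟩
  · obtain ⟨h1, h2, _⟩ := key ⟨f, hf⟩
    exact (LinearPMap.mem_domain_natComp _ _ _).2 ⟨h1, h2⟩
  · obtain ⟨u, hu⟩ := u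
    obtain rfl : (f : N.HE) = u := hfu
    obtain ⟨h1, h2, h3⟩ := key f
    rw [LinearPMap.natComp_apply _ _ _ h1 h2, h3]

theorem isClosable_lapECore (o : G) : (N.lapECore o).IsClosable :=
  (N.isSelfAdjoint_J_J_adjoint o).isClosed.isClosable.leIsClosable (N.lapECore_le o)

theorem lapE_le (o : G) : N.lapE o ≤ N.J.natComp N.J† := by
  refine LinearPMap.le_of_le_graph ?_
  rw [lapE, ← (N.isClosable_lapECore o).graph_closure_eq_closure_graph]
  exact Submodule.topologicalClosure_minimal _ (LinearPMap.le_graph_of_le (N.lapECore_le o))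
    (N.isSelfAdjoint_J_J_adjoint o).isClosed

theorem lapECore_le_lapE (o : G) : N.lapECore o ≤ N.lapE o := (N.lapECore o).le_closure

theorem dense_lapE_domain (o : G) : Dense ((N.lapE o).domain : Set N.HE) := by
  refine (N.dense_energyCoreDomain o).mono ?_
  rw [← N.lapECore_domain o]
  exact (N.lapECore_le_lapE o).1

theorem harm_le_kernel (o : G) : N.Harm ≤ (N.J.natComp N.J†).kernel := by
  intro u hu
  have h0 : ⇑(0 : EllTwo G) = N.lapHE u := by
    rw [LinearMap.mem_ker.1 hu]
    rfl
  have hu' := N.mem_J_adjoint_domain o h0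
  have h1 := N.J_adjoint_apply o h0 hu'
  have h2 : N.J† ⟨u, hu'⟩ ∈ N.J.domain := h1 ▸ N.J.domain.zero_mem
  refine (LinearPMap.mem_kernel _ _).2
    ⟨(LinearPMap.mem_domain_natComp _ _ _).2 ⟨hu', h2⟩, ?_⟩
  rw [LinearPMap.natComp_apply _ _ _ hu' h2,
    show (⟨N.J† ⟨u, hu'⟩, h2⟩ : N.J.domain) = 0 from Subtype.ext h1, LinearPMap.map_zero]

/-! ### Kernel of the adjoint of the energy Laplacian -/

theorem lapECore_energyKernel (o x : G) (h : N.energyKernel o x ∈ (N.lapECore o).domain) :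
    N.lapECore o ⟨N.energyKernel o x, h⟩ = N.diracHE x - N.diracHE o := by
  rw [diracHE, diracHE, ← map_sub]
  change N.toHE _ = N.toHE _
  congr 1
  ext y
  exact congrFun (N.lapHE_energyKernel o x) y

theorem lapECore_isMinMonopole {o : G} {w : N.HE} (hw : N.IsMinMonopole o w)
    (h : w ∈ (N.lapECore o).domain) : N.lapECore o ⟨w, h⟩ = N.diracHE o := by
  change N.toHE _ = N.toHE _
  congr 1
  ext y
  exact congrFun hw.1 y

theorem energyKernel_mem (o x : G) : N.energyKernel o x ∈ (N.lapECore o).domain := by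
  rw [lapECore_domain]
  exact Submodule.subset_span (Or.inl ⟨x, rfl⟩)

theorem isMinMonopole_mem {o : G} {w : N.HE} (hw : N.IsMinMonopole o w) :
    w ∈ (N.lapECore o).domain := by
  rw [lapECore_domain]
  exact Submodule.subset_span (Or.inr hw)

theorem kernel_lapE_adjoint (o : G) : (N.lapE o)†.kernel = N.Harm := by
  apply le_antisymm
  · intro u hu
    obtain ⟨hu1, hu2⟩ := (LinearPMap.mem_kernel _ _).1 hu
    have h : ∀ z : (N.lapECore o).domain, inner ℝ u (N.lapECore o z) = 0 := by
      intro z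
      have h1 := LinearPMap.adjoint_isFormalAdjoint (N.dense_lapE_domain o) ⟨u, hu1⟩
        ⟨z, (N.lapECore_le_lapE o).1 z.2⟩
      rw [hu2, inner_zero_left] at h1
      rw [(N.lapECore_le_lapE o).2 (x := z) (y := ⟨z, (N.lapECore_le_lapE o).1 z.2⟩) rfl]
      exact h1.symm
    have hconst : ∀ x, N.lapHE u x = N.lapHE u o := by
      intro x
      have h1 := h ⟨_, N.energyKernel_mem o x⟩
      rw [lapECore_energyKernel, inner_sub_right, real_inner_comm,
        real_inner_comm (N.diracHE o), inner_diracHE, inner_diracHE] at h1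
      linarith
    have hzero : N.lapHE u o = 0 := by
      by_contra hk
      -- A nonzero constant Laplacian produces a monopole in the core, and pairing u with Δw = δ_o
      -- returns Δu(o) = 0.
      obtain ⟨w, hw⟩ := N.exists_isMinMonopole_of_lapHE_eq_const o hk hconst
      have h1 := h ⟨_, N.isMinMonopole_mem hw⟩
      rw [lapECore_isMinMonopole _ hw, real_inner_comm, inner_diracHE] at h1
      exact hk h1
    refine LinearMap.mem_ker.2 ?_
    ext x
    rw [hconst, hzero]
    rfl
  · intro u hu
    obtain ⟨hu1, hu2⟩ := (LinearPMap.mem_kernel _ _).1 (N.harm_le_kernel o hu)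
    -- Symmetry of the extension `JJ†`, which annihilates u.
    have key : ∀ z : (N.lapE o).domain, inner ℝ (0 : N.HE) (z : N.HE) =
        inner ℝ u (N.lapE o z) := by
      intro z
      rw [(N.lapE_le o).2 (x := z) (y := ⟨z, (N.lapE_le o).1 z.2⟩) rfl]
      have h1 := (N.isSelfAdjoint_J_J_adjoint o).isFormalAdjoint ⟨u, hu1⟩
        ⟨z, (N.lapE_le o).1 z.2⟩
      rwa [hu2] at h1
    exact (LinearPMap.mem_kernel _ _).2 ⟨LinearPMap.mem_adjoint_domain_of_exists _ ⟨_, key⟩,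
      LinearPMap.adjoint_apply_eq (N.dense_lapE_domain o) _ key⟩

/-! ### Minimality among the non-negative self-adjoint extensions -/

/-- On a finite network the Laplacian of any function sums to zero. -/
theorem sum_lapHE [Fintype G] (u : N.HE) : ∑ x, N.lapHE u x = 0 := by
  let e : N.domEnergy := ⟨1, N.mem_domEnergy_of_finite_support (Set.toFinite _)⟩
  have h := N.inner_toHE_of_support u e (s := Finset.univ) (by simp)
  rw [N.toHE_eq_zero.2 (N.mem_constants.2 ⟨1, fun x => rfl⟩), inner_zero_right] at h
  rw [h]
  exact Finset.sum_congr rfl fun x _ => (one_mul _).symm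

/-- A vector on which `Δ` is bounded in the sense of the form on the core of the energy Laplacian
belongs to the domain of `J*`. -/
theorem exists_J_adjoint_of_bound (o : G) (w : N.HE) {C : ℝ} (hC : 0 ≤ C)
    (h : ∀ (z : (N.lapECore o).domain) (hz : (z : N.HE) ∈ N.J†.domain),
      |inner ℝ w (N.lapECore o z)| ≤ C * ‖N.J† ⟨z, hz⟩‖) :
    ∃ hw : w ∈ N.J†.domain, ‖N.J† ⟨w, hw⟩‖ ≤ C := by
  have hle : (N.lapECore o).domain ≤ N.J†.domain := fun u hu =>
    N.mem_J_adjoint_domain_of_mem_core (N.lapECore_domain o ▸ hu)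
  obtain ⟨g, hgn, hg⟩ := (N.J†.toFun.comp (Submodule.inclusion hle)).exists_inner_eq_of_bound
    ((innerₛₗ ℝ w).comp (N.lapECore o).toFun) hC fun z => h z (hle z.2)
  have hg' : ∀ (z : (N.lapECore o).domain),
      inner ℝ g (N.J† ⟨z, hle z.2⟩) = inner ℝ w (N.lapECore o z) := hg
  -- Dipoles see only differences δ_x - δ_o, so g agrees with Δw up to a constant; a monopole in the
  -- core would fix the constant to be zero.
  have hconst : ∀ x, N.lapHE w x = g x + (N.lapHE w o - g o) := by
    intro x
    have h1 := hg' ⟨_, N.energyKernel_mem o x⟩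
    rw [lapECore_energyKernel, inner_sub_right, real_inner_comm (N.diracHE x),
      real_inner_comm (N.diracHE o), inner_diracHE, inner_diracHE,
      N.J_adjoint_apply o (g := diracL2 x - diracL2 o) (N.lapHE_energyKernel o x).symm,
      inner_sub_right, inner_diracL2, inner_diracL2] at h1
    linarith
  have hmono : (∃ m, N.IsMinMonopole o m) → N.lapHE w o - g o = 0 := by
    rintro ⟨m, hm⟩
    have h1 := hg' ⟨_, N.isMinMonopole_mem hm⟩
    rw [lapECore_isMinMonopole _ hm, real_inner_comm (N.diracHE o), inner_diracHE,
      N.J_adjoint_apply o (g := diracL2 o) hm.1.symm, inner_diracL2] at h1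
    linarith
  have hzero : N.lapHE w o - g o = 0 → ∃ hw : w ∈ N.J†.domain, ‖N.J† ⟨w, hw⟩‖ ≤ C := by
    intro hk
    have h1 : ⇑g = N.lapHE w := by
      ext x
      rw [hconst x, hk, add_zero]
    exact ⟨N.mem_J_adjoint_domain o h1, by rwa [N.J_adjoint_apply o h1]⟩
  rcases finite_or_infinite G with hG | hG
  · have := Fintype.ofFinite G
    let d : EllTwo G := ⟨N.lapHE w, memEllTwo (Set.toFinite _)⟩
    refine ⟨N.mem_J_adjoint_domain o (g := d) rfl, ?_⟩
    rw [N.J_adjoint_apply o (g := d) rfl]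
    -- The constant need not vanish on a finite network, but d = Δw sums to zero and so is
    -- orthogonal to the constant d - g; this gives ‖d‖ ≤ ‖g‖.
    have h1 : inner ℝ d d = inner ℝ d g := by
      have h2 := N.sum_lapHE w
      rw [lp.inner_eq_tsum, lp.inner_eq_tsum, tsum_fintype, tsum_fintype, ← sub_eq_zero,
        ← Finset.sum_sub_distrib, ← mul_zero (N.lapHE w o - g o), ← h2, Finset.mul_sum]
      refine Finset.sum_congr rfl fun x _ => ?_
      rw [← inner_sub_right]
      change inner ℝ (N.lapHE w x) (N.lapHE w x - g x) = _
      rw [show N.lapHE w x - g x = N.lapHE w o - g o by rw [hconst x]; ring]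
      rfl
    have h3 := real_inner_le_norm d g
    rw [← h1, real_inner_self_eq_norm_mul_norm] at h3
    refine le_trans ?_ hgn
    by_contra hlt
    nlinarith [norm_nonneg g, norm_nonneg d]
  · refine hzero ?_
    by_contra hk
    exact hk (hmono (N.exists_isMinMonopole_of_lapHE_eq_add_const o hk g hconst))

theorem resolventLE_of_extension (o : G) {T : N.HE →ₗ.[ℝ] N.HE} (hT : IsSelfAdjoint T)
    (hn : T.IsNonneg) (hle : N.lapE o ≤ T) : LinearPMap.ResolventLE (N.J.natComp N.J†) T := by
  intro f u w hu hw
  have hcore := (N.lapECore_le_lapE o).trans hle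
  obtain ⟨hwJ, hwn⟩ := N.exists_J_adjoint_of_bound o w
    (Real.sqrt_nonneg (inner ℝ (w : N.HE) (T w))) fun z hz => by
      have h1 := hn.inner_sq_le hT.isFormalAdjoint w ⟨z, hcore.1 z.2⟩
      rw [← hcore.2 (x := z) (y := ⟨z, hcore.1 z.2⟩) rfl] at h1
      have h2 : inner ℝ (z : N.HE) (N.lapECore o z) = ‖N.J† ⟨z, hz⟩‖ ^ 2 := by
        rw [(N.lapECore_le o).2 (x := z) (y := ⟨z, (N.lapECore_le o).1 z.2⟩) rfl, real_inner_comm,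
          ← real_inner_self_eq_norm_sq]
        exact LinearPMap.natComp_self_adjoint_inner N.dense_J_domain _ ⟨z, hz⟩ hz
      refine abs_le_of_sq_le_sq ?_ (by positivity)
      rw [mul_pow, Real.sq_sqrt (hn w), ← h2]
      exact h1
  obtain ⟨huJ, _⟩ := (LinearPMap.mem_domain_natComp _ _ _).1 u.2
  have h1 := LinearPMap.natComp_self_adjoint_inner N.dense_J_domain u ⟨w, hwJ⟩ huJ
  have h2 := LinearPMap.natComp_self_adjoint_inner N.dense_J_domain u ⟨u, huJ⟩ huJ
  have h3 : ‖N.J† ⟨w, hwJ⟩‖ ^ 2 ≤ inner ℝ (w : N.HE) (T w) := by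
    rw [← Real.sq_sqrt (hn w)]
    gcongr
  have h4 : inner ℝ f (w : N.HE) =
      inner ℝ (u : N.HE) (w : N.HE) + inner ℝ (N.J† ⟨u, huJ⟩) (N.J† ⟨w, hwJ⟩) := by
    rw [← hu, inner_add_left, ← h1]
  have h5 : inner ℝ f (u : N.HE) = ‖(u : N.HE)‖ ^ 2 + ‖N.J† ⟨u, huJ⟩‖ ^ 2 := by
    rw [← hu, inner_add_left, ← real_inner_self_eq_norm_sq, ← real_inner_self_eq_norm_sq, ← h2]
  have h6 : inner ℝ f (w : N.HE) = ‖(w : N.HE)‖ ^ 2 + inner ℝ (w : N.HE) (T w) := by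
    rw [← hw, inner_add_left, real_inner_self_eq_norm_sq, real_inner_comm (T w)]
  have h7 := norm_sub_sq_real (u : N.HE) w
  have h8 := norm_sub_sq_real (N.J† ⟨u, huJ⟩) (N.J† ⟨w, hwJ⟩)
  -- Expanding, 0 ≤ ‖u - w‖² + ‖J†(u - w)‖² = ⟨f, u⟩ - 2⟨f, w⟩ + ‖w‖² + ‖J†w‖², and the last two
  -- terms are at most ⟨f, w⟩.
  nlinarith [sq_nonneg ‖(u : N.HE) - w‖, sq_nonneg ‖N.J† ⟨u, huJ⟩ - N.J† ⟨w, hwJ⟩‖]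

end Network

theorem mainTheorem1 {G : Type*} (N : Network G) (o : G) :
    -- the three operators whose closures are taken are closable
    (N.inclusion.IsClosable ∧ N.lapL2Core.IsClosable ∧ (N.lapECore o).IsClosable) ∧
    -- (i)
    (IsSelfAdjoint N.lapL2 ∧ N.J†.natComp N.J = N.lapL2) ∧
    -- (ii)
    ((N.lapE o)†.kernel = N.Harm ∧
      LinearPMap.IsKreinExtension (N.lapE o) (N.J.natComp N.J†) ∧
      LinearPMap.IsLeastNonnegExtension (N.lapE o) (N.J.natComp N.J†)) := by
  have hK := N.isSelfAdjoint_J_J_adjoint o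
  refine ⟨⟨N.isClosable_inclusion o, ?_, N.isClosable_lapECore o⟩,
    ⟨N.lapL2_eq o ▸ N.isSelfAdjoint_J_adjoint_J o, (N.lapL2_eq o).symm⟩,
    N.kernel_lapE_adjoint o, ⟨hK, N.lapE_le o, ?_⟩, hK,
    LinearPMap.isNonneg_natComp_self_adjoint N.dense_J_domain, N.lapE_le o,
    fun T hT hn hle => N.resolventLE_of_extension o hT hn hle⟩
  · exact (N.isSelfAdjoint_J_adjoint_J o).isClosed.isClosable.leIsClosable (N.lapL2Core_le o)
  · rw [N.kernel_lapE_adjoint o]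
    exact N.harm_le_kernel o
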